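/- A *cLD election* $(G(N,E),v,d)$ consists of a finite directed graph $G(N,E)$ whose vertices are the voters (an edge from $i$ to $j$ means that $i$ approves $j$ as an immediate representative) and, for each voter $i\in N$, a voting cost $v(i)\in\mathbb N$ and a delegating cost $d(i)\in\mathbb N$, both of which may be zero. Let $\Delta$ be the maximum out-degree of $G$. A *solution* is a pair $(C,D)$, where $C\subseteq N$ is the set of casting voters and $D\subseteq E$ consists of exactly one outgoing edge for each voter in $N\setminus C$. For $j\in C$ let $R_j$ be the set of voters in $N\setminus C$ that have a directed path to $j$ using only edges of $D$; the *voting power* of $j$ is $|R_j|+1$. The decision problem Bounded Power takes as input a cLD election $(G(N,E),v,d)$, a budget $\beta\in\mathbb N$ with $\beta\ge 1$ and a bound $\ell\in\mathbb N$ with $\ell\ge 1$, all numbers being written in binary. It asks whether there is a solution $(C,D)$ such that 1. $\sum_{i\in C}v(i)+\sum_{i\in N\setminus C}d(i)\le\beta$; 2. every voter in $N\setminus C$ has a directed path to a voter in $C$ using only edges of $D$; 3. the voting power of every voter in $C$ is at most $\ell$. **Theorem.** Restricted to inputs with $\Delta\le 1$, Bounded Power is solvable in polynomial time: there is a deterministic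 Turing machine that, on the encoding of any input with $\Delta\le 1$, decides the question correctly after a number of steps bounded by a polynomial in the length of the encoding. -/

import Mathlib

/-- `P` is decided in polynomial time: some Turing machine, started on the encoding `enc a` of any
input `a`, outputs the truth value of `P a` after a number of steps bounded by a polynomial in the
length of `enc a`. -/
def DecidableInPolyTime {α Γ : Type} (enc : α → List Γ) (P : α → Prop) : Prop :=
  ∃ f : α → Bool, (∀ a, f a = true ↔ P a) ∧
    Nonempty (Turing.TM2ComputableInPolyTime enc Computability.encodeBool f)

/-- A Liquid Democracy election under costs: `graph.Adj i j` means that voter `i` approves voter `j`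
as an immediate representative. -/
structure CLDElection (N : Type) where
  /-- the delegation graph -/
  graph : Digraph N
  /-- the cost of casting a ballot -/
  votingCost : N → ℕ
  /-- the cost of delegating -/
  delegationCost : N → ℕ

namespace CLDElection

variable {N : Type}

/-- The number of out-neighbours of voter `i`. -/
noncomputable def outDegree (e : CLDElection N) (i : N) : ℕ :=
  {j : N | e.graph.Adj i j}.ncard

/-- The maximum out-degree `Δ` of the delegation graph. -/
noncomputable def maxOutDegree [Fintype N] (e : CLDElection N) : ℕ :=
  Finset.univ.sup e.outDegree

/-- `(C, D)` is a solution: `D` is a set of edges of the delegation graph consisting of exactly one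
outgoing edge for each voter outside of `C` (and of no other edges). -/
structure IsSolution (e : CLDElection N) (C : Finset N) (D : Set (N × N)) : Prop where
  edge : ∀ i j, (i, j) ∈ D → e.graph.Adj i j
  casting : ∀ i j, (i, j) ∈ D → i ∉ C
  delegating : ∀ i, i ∉ C → ∃! j, (i, j) ∈ D

/-- There is a directed path from `i` to `j` that uses only edges in `D`. -/
def HasPath (D : Set (N × N)) (i j : N) : Prop :=
  Relation.ReflTransGen (fun a b => (a, b) ∈ D) i j

/-- The total cost when exactly the voters in `C` cast a ballot. -/
def cost [Fintype N] [DecidableEq N] (e : CLDElection N) (C : Finset N) : ℕ :=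
  ∑ i ∈ C, e.votingCost i + ∑ i ∈ Cᶜ, e.delegationCost i

/-- Every delegating voter has a path to some casting voter. -/
def Reachability (C : Finset N) (D : Set (N × N)) : Prop :=
  ∀ i, i ∉ C → ∃ j ∈ C, HasPath D i j

/-- The set `R_j` of delegating voters represented by the voter `j`. -/
def represented (C : Finset N) (D : Set (N × N)) (j : N) : Set N :=
  {i | i ∉ C ∧ HasPath D i j}

/-- The voting power `|R_j| + 1` of the casting voter `j`. -/
noncomputable def votingPower (C : Finset N) (D : Set (N × N)) (j : N) : ℕ :=
  (represented C D j).ncard + 1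

end CLDElection

/-- An input of Bounded Power: an election on the voters `0, …, n - 1`, a positive budget and a
positive bound on the voting power. -/
structure BoundedPowerInstance where
  /-- the number of voters -/
  n : ℕ
  /-- the election -/
  election : CLDElection (Fin n)
  /-- the budget `β` -/
  budget : ℕ+
  /-- the bound `ℓ` on the voting power -/
  bound : ℕ+

namespace BoundedPowerInstance

open Computability

/-- The question asked by Bounded Power: is there a solution that satisfies the cost constraint and
the reachability constraint, and in which the voting power of no casting voter exceeds `ℓ`? -/
def IsYes (I : BoundedPowerInstance) : Prop :=
  ∃ (C : Finset (Fin I.n)) (D : Set (Fin I.n × Fin I.n)),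
    I.election.IsSolution C D ∧
    I.election.cost C ≤ I.budget ∧
    CLDElection.Reachability C D ∧
    ∀ j ∈ C, CLDElection.votingPower C D j ≤ I.bound

/-- A natural number in binary, followed by a comma. -/
def encodeNumber (m : ℕ) : List Γ' :=
  (encodeNat m).map Γ'.bit ++ [Γ'.comma]

open Classical in
/-- The row of the voter `i` in the adjacency matrix of the delegation graph, as `n` bits followed
by a comma. -/
noncomputable def encodeRow (I : BoundedPowerInstance) (i : Fin I.n) : List Γ' :=
  (List.finRange I.n).map (fun j => Γ'.bit (decide (I.election.graph.Adj i j))) ++ [Γ'.comma]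

/-- The encoding of an instance: the budget and the bound in binary and then, for each voter, the
row of the adjacency matrix and the two costs in binary. -/
noncomputable def encode (I : BoundedPowerInstance) : List Γ' :=
  encodeNumber I.budget ++ encodeNumber I.bound ++
    (List.finRange I.n).flatMap fun i =>
      I.encodeRow i ++ encodeNumber (I.election.votingCost i) ++
        encodeNumber (I.election.delegationCost i)

end BoundedPowerInstance

/-! When Δ ≤ 1 the delegation graph is a partial function, so a solution is determined by its set of
casting voters. Make the function total by letting a voter without an out-edge be its own successor.
Let `f i` be the power that `i` passes on: 0 if `i` casts, and otherwise 1 plus its inflow, the sum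
of `f` over its predecessors. The local conditions in `IsFlow` capture the whole problem
(`exists_isFlow_iff`). Along a delegation the inflow strictly increases, so delegations cannot run
in a cycle, and since inflows are less than the number of voters every delegation ends at a casting
voter. Moreover inflow plus one bounds the voting power. In particular a voter that is its own
successor cannot delegate.

It remains to minimise a cost that is a sum over the vertices of a functional graph. Each vertex
carries a table of triples (inflow, outflow, cost), and vertices are eliminated one by one. A vertex
without other predecessors is merged into its successor, to whose inflow it contributes. If no such
vertex exists, the successor map is a permutation (`WellFormed.succ_injOn`), and a vertex is merged
with its successor by composing the two tables. A vertex that is its own successor is closed by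
requiring inflow = outflow, and its cost is added to a running total. Each step preserves the set of
budgets that suffice (`solvable_elimStep`), so in the end only the total has to be compared with the
budget (`solvable_elimAll`).

This takes polynomial time although costs are binary: flows are at most the number n of voters, so
at most (n + 1)² entries per table are worth keeping, and each elimination lengthens the costs by at
most one digit.

For the Turing machine, all data are coded as binary trees on a stack. `PolyFn` is the class of
functions computed on such codes in polynomial time by a piece of a multi-stack machine. It is
closed under composition, pairing, case distinction and folds whose intermediate values are
polynomially bounded; the decision procedure is built from these, and
`decidableInPolyTime_of_polyFn` adds input and output. -/

open Computability Turing Function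

/-! ### Pieces of stack machines and their composition. -/

namespace StackProgram

/-- The stacks of the machines built below: input, output, the main stack, and three auxiliary
stacks. -/
inductive Stack
  | inp | main | a | b | c | out
  deriving DecidableEq

instance : Fintype Stack where
  elems := {.inp, .main, .a, .b, .c, .out}
  complete k := by cases k <;> decide

/-- The alphabet of a stack. -/
abbrev Alphabet : Stack → Type
  | .out => Bool
  | _ => Γ'

/-- The contents of all stacks. -/
abbrev Stacks := ∀ k, List (Alphabet k)

/-- A symbol of any stack, as a symbol of `Γ'`. -/
def sym : ∀ k, Alphabet k → Γ'
  | .out, x => .bit x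
  | .inp, x => x
  | .main, x => x
  | .a, x => x
  | .b, x => x
  | .c, x => x

/-- Stack contents with an empty output stack. -/
def stk (i m a b c : List Γ') : Stacks
  | .inp => i
  | .main => m
  | .a => a
  | .b => b
  | .c => c
  | .out => []

section stk
variable (i m a b c x : List Γ')

@[simp] lemma stk_inp : stk i m a b c .inp = i := rfl
@[simp] lemma stk_main : stk i m a b c .main = m := rfl
@[simp] lemma stk_a : stk i m a b c .a = a := rfl
@[simp] lemma stk_b : stk i m a b c .b = b := rfl
@[simp] lemma stk_c : stk i m a b c .c = c := rfl
@[simp] lemma update_inp : update (stk i m a b c) .inp x = stk x m a b c := by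
  funext k; cases k <;> rfl
@[simp] lemma update_main : update (stk i m a b c) .main x = stk i x a b c := by
  funext k; cases k <;> rfl
@[simp] lemma update_a : update (stk i m a b c) .a x = stk i m x b c := by
  funext k; cases k <;> rfl
@[simp] lemma update_b : update (stk i m a b c) .b x = stk i m a x c := by
  funext k; cases k <;> rfl
@[simp] lemma update_c : update (stk i m a b c) .c x = stk i m a b x := by
  funext k; cases k <;> rfl

end stk

/-- Renaming the labels of a statement. -/
def mapStmt {Λ Λ' : Type} (h : Λ → Λ') :
    TM2.Stmt Alphabet Λ (Option Γ') → TM2.Stmt Alphabet Λ' (Option Γ')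
  | .push k f q => .push k f (mapStmt h q)
  | .peek k f q => .peek k f (mapStmt h q)
  | .pop k f q => .pop k f (mapStmt h q)
  | .load f q => .load f (mapStmt h q)
  | .branch f q₁ q₂ => .branch f (mapStmt h q₁) (mapStmt h q₂)
  | .goto f => .goto fun v => h (f v)
  | .halt => .halt

lemma stepAux_mapStmt {Λ Λ' : Type} (h : Λ → Λ') (q : TM2.Stmt Alphabet Λ (Option Γ'))
    (v : Option Γ') (S : Stacks) :
    TM2.stepAux (mapStmt h q) v S =
      ⟨(TM2.stepAux q v S).l.map h, (TM2.stepAux q v S).var, (TM2.stepAux q v S).stk⟩ := by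
  induction q generalizing v S with
  | branch f q₁ q₂ h₁ h₂ => cases hf : f v <;> simp [mapStmt, hf, h₁, h₂]
  | _ => simp_all [mapStmt]

/-- A piece of a machine with one entry; a jump to `none` leaves the piece. -/
structure Frag where
  /-- the labels -/
  Λ : Type
  /-- there are finitely many labels -/
  fin : Fintype Λ
  /-- the label at which the piece is entered -/
  entry : Λ
  /-- the program -/
  m : Λ → TM2.Stmt Alphabet (Option Λ) (Option Γ')

namespace Frag

/-- Started at label `l`, the piece is left after exactly `t` steps. -/
inductive RunsFrom (F : Frag) : F.Λ → Option Γ' → Stacks → Stacks → ℕ → Prop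
  | exit {l v v' S S'} : TM2.stepAux (F.m l) v S = ⟨some none, v', S'⟩ → RunsFrom F l v S S' 1
  | step {l l' v v' S S' S'' t} : TM2.stepAux (F.m l) v S = ⟨some (some l'), v', S'⟩ →
      RunsFrom F l' v' S' S'' t → RunsFrom F l v S S'' (t + 1)

/-- Started at its entry on the stacks `S`, the piece is left with the stacks `S'` after at most
`T` steps. -/
def Runs (F : Frag) (S S' : Stacks) (T : ℕ) : Prop :=
  ∀ v, ∃ t ≤ T, F.RunsFrom F.entry v S S' t

lemma Runs.mono {F : Frag} {S S' : Stacks} {T T' : ℕ} (h : F.Runs S S' T) (hT : T ≤ T') :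
    F.Runs S S' T' := fun v =>
  let ⟨t, ht, hr⟩ := h v
  ⟨t, ht.trans hT, hr⟩

/-- Leave the piece at once. -/
def skip : Frag where
  Λ := Unit
  fin := inferInstance
  entry := ()
  m _ := .goto fun _ => none

/-- Push one symbol. -/
def push (k : Stack) (x : Alphabet k) : Frag where
  Λ := Unit
  fin := inferInstance
  entry := ()
  m _ := .push k (fun _ => x) (.goto fun _ => none)

/-- Sequential composition. -/
def seq (F G : Frag) : Frag where
  Λ := F.Λ ⊕ G.Λ
  fin := @instFintypeSum _ _ F.fin G.fin
  entry := .inl F.entry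
  m := Sum.elim
    (fun l => mapStmt (fun o => o.elim (some (.inr G.entry)) (fun x => some (.inl x))) (F.m l))
    (fun l => mapStmt (Option.map .inr) (G.m l))

/-- Pop a symbol `x` from stack `k`, run `body x`, and start again if `again x`; leave the piece
if the stack is empty. -/
def sw (k : Stack) (body : Γ' → Frag) (again : Γ' → Bool) : Frag where
  Λ := Option (Σ x, (body x).Λ)
  fin := @instFintypeOption _ (@Sigma.instFintype _ _ (fun x => (body x).fin) _)
  entry := none
  m
    | none => .pop k (fun _ o => o.map (sym k))
        (.goto fun v => v.map fun x => some ⟨x, (body x).entry⟩)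
    | some ⟨x, l⟩ => mapStmt
        (fun o => o.elim (bif again x then some none else none) (fun l' => some (some ⟨x, l'⟩)))
        ((body x).m l)

lemma skip_runs (S : Stacks) : skip.Runs S S 1 := fun v => ⟨1, le_rfl, .exit (v' := v) rfl⟩

lemma push_runs (k : Stack) (x : Alphabet k) (S : Stacks) :
    (push k x).Runs S (update S k (x :: S k)) 1 := fun v => ⟨1, le_rfl, .exit (v' := v) rfl⟩

lemma seq_runsFrom_right {F G : Frag} {l v S S' t} (h : G.RunsFrom l v S S' t) :
    (F.seq G).RunsFrom (.inr l) v S S' t := by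
  induction h with
  | @exit _ _ v' _ _ h => exact .exit (v' := v') (by simp [seq, stepAux_mapStmt, h])
  | step h _ ih => exact .step (by simp [seq, stepAux_mapStmt, h]) ih

/-- The jump of `F` to `none` is relabelled as a jump to the entry of `G`, so the change of pieces
costs no extra step. -/
lemma seq_runsFrom_left {F G : Frag} {l v S S' S'' t T} (h : F.RunsFrom l v S S' t)
    (h' : G.Runs S' S'' T) : ∃ t' ≤ t + T, (F.seq G).RunsFrom (.inl l) v S S'' t' := by
  induction h with
  | exit h =>
    rename_i v' S _
    obtain ⟨t, ht, hr⟩ := h' v'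
    refine ⟨t + 1, by omega, .step ?_ (seq_runsFrom_right hr)⟩
    simp [seq, stepAux_mapStmt, h]
  | step h _ ih =>
    obtain ⟨t, ht, hr⟩ := ih h'
    refine ⟨t + 1, by omega, .step ?_ hr⟩
    simp [seq, stepAux_mapStmt, h]

/-- `Runs` quantifies over the initial register value, so nothing needs to be known about what `F`
leaves in the register. -/
lemma Runs.seq {F G : Frag} {S S' S'' T T'} (h : F.Runs S S' T) (h' : G.Runs S' S'' T') :
    (F.seq G).Runs S S'' (T + T') := fun v => by
  obtain ⟨t, ht, hr⟩ := h v
  obtain ⟨t', ht', hr'⟩ := seq_runsFrom_left hr h'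
  exact ⟨t', by omega, hr'⟩

variable {k : Stack} {body : Γ' → Frag} {again : Γ' → Bool} {S S' S'' : Stacks} {T T' : ℕ}

lemma sw_runs_nil (h : S k = []) : (sw k body again).Runs S S 1 := fun v => by
  refine ⟨1, le_rfl, .exit (v' := none) ?_⟩
  have : update S k [] = S := by rw [← h, update_eq_self]
  simp [sw, h, this]

lemma sw_runsFrom_stop {x l v S S' t} (ha : again x = false) (h : (body x).RunsFrom l v S S' t) :
    (sw k body again).RunsFrom (some ⟨x, l⟩) v S S' t := by
  induction h with
  | @exit _ _ v' _ _ h => exact .exit (v' := v') (by simp [sw, stepAux_mapStmt, h, ha])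
  | step h _ ih =>
    exact .step (by simp [sw, stepAux_mapStmt, h]) ih

lemma sw_runsFrom_again {x l v S S' S'' t} (ha : again x = true)
    (h : (body x).RunsFrom l v S S' t) (h' : (sw k body again).Runs S' S'' T) :
    ∃ t' ≤ t + T, (sw k body again).RunsFrom (some ⟨x, l⟩) v S S'' t' := by
  induction h with
  | exit h =>
    rename_i v' _ _
    obtain ⟨t, ht, hr⟩ := h' v'
    refine ⟨t + 1, by omega, .step ?_ hr⟩
    simp [sw, stepAux_mapStmt, h, ha]
  | step h _ ih =>
    obtain ⟨t, ht, hr⟩ := ih h'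
    refine ⟨t + 1, by omega, .step ?_ hr⟩
    simp [sw, stepAux_mapStmt, h]

lemma sw_runs_stop {x : Alphabet k} {r} (h : S k = x :: r) (ha : again (sym k x) = false)
    {S₁ : Stacks} (hu : update S k r = S₁) (hb : (body (sym k x)).Runs S₁ S' T) :
    (sw k body again).Runs S S' (T + 1) := fun v => by
  subst hu
  obtain ⟨t, ht, hr⟩ := hb (some (sym k x))
  refine ⟨t + 1, by omega, .step ?_ (sw_runsFrom_stop ha hr)⟩
  simp [sw, h]

lemma sw_runs_again {x : Alphabet k} {r} (h : S k = x :: r) (ha : again (sym k x) = true)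
    {S₁ : Stacks} (hu : update S k r = S₁) (hb : (body (sym k x)).Runs S₁ S' T)
    (h' : (sw k body again).Runs S' S'' T') :
    (sw k body again).Runs S S'' (T + T' + 1) := fun v => by
  subst hu
  obtain ⟨t, ht, hr⟩ := hb (some (sym k x))
  obtain ⟨t', ht', hr'⟩ := sw_runsFrom_again ha hr h'
  refine ⟨t' + 1, by omega, .step ?_ hr'⟩
  simp [sw, h]

/-- The machine that runs the piece and then halts. -/
def toFinTM2 (F : Frag) : FinTM2 where
  K := Stack
  k₀ := .inp
  k₁ := .out
  Γ := Alphabet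
  Λ := Option F.Λ
  main := some F.entry
  ΛFin := @instFintypeOption _ F.fin
  σ := Option Γ'
  initialState := none
  Γk₀Fin := inferInstanceAs (Fintype Γ')
  m
    -- A halting configuration must have the initial register value again, so the register is reset
    -- before halting.
    | none => .load (fun _ => none) .halt
    | some l => F.m l

/-- The additional step is the final one that resets the register and halts. -/
lemma iterate_step_of_runsFrom {F : Frag} {l v S S' t} (h : F.RunsFrom l v S S' t) :
    (flip bind F.toFinTM2.step)^[t + 1] (some ⟨some (some l), v, S⟩) =
      some (⟨none, none, S'⟩ : F.toFinTM2.Cfg) := by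
  induction h with
  | exit h =>
    rename_i l v v' S S'
    have h1 : F.toFinTM2.step ⟨some (some l), v, S⟩ = some ⟨some none, v', S'⟩ := by
      simp only [FinTM2.step, toFinTM2]
      exact congrArg some h
    exact (congrArg (· >>= F.toFinTM2.step) h1).trans rfl
  | step h _ ih =>
    rename_i l l' v v' S S' S'' t _
    have h1 : F.toFinTM2.step ⟨some (some l), v, S⟩ = some ⟨some (some l'), v', S'⟩ := by
      simp only [FinTM2.step, toFinTM2]
      exact congrArg some h
    rw [iterate_succ_apply]
    exact (congrArg (flip bind F.toFinTM2.step)^[t + 1] h1).trans ih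

end Frag

end StackProgram

/-! ### Binary trees coded on stacks, and machine pieces that handle them. -/

namespace StackProgram

/-- Binary trees, the universal data type. -/
inductive BinTree
  | nil
  | cons (x y : BinTree)

namespace BinTree

/-- The preorder traversal of a tree, as a string of bits. -/
def code : BinTree → List Γ'
  | nil => [.bit false]
  | cons x y => .bit true :: (code x ++ code y)

/-- The length of the code of a tree. -/
def size : BinTree → ℕ
  | nil => 1
  | cons x y => size x + size y + 1

lemma size_pos (t : BinTree) : 1 ≤ t.size := by cases t <;> simp [size]

lemma length_code (t : BinTree) : t.code.length = t.size := by
  induction t with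
  | nil => rfl
  | cons x y hx hy => simp [code, size, hx, hy]

end BinTree

open BinTree

/-- Stack contents with only the main stack in use. -/
abbrev onMain (m : List Γ') : Stacks := stk [] m [] [] []

namespace Frag

/-- Read a symbol from the main stack and run `P` on it; push two symbols on stack `c` if two trees
follow. -/
def readSymbol (P : Γ' → Frag) : Frag :=
  sw .main (fun x => match x with
    | .bit true => (P (.bit true)).seq ((push .c (.bit true)).seq (push .c (.bit true)))
    | x => P x) (fun _ => false)

/-- Read a tree from the main stack, and run `P` on each symbol; stack `c` counts the trees that
remain to be read. -/
def readLoop (P : Γ' → Frag) : Frag := sw .c (fun _ => readSymbol P) (fun _ => true)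

/-- Preorder codes are self-delimiting: a pair symbol settles one pending tree and creates two,
`nil` settles one. The map `g` describes the stacks by unread input, symbols already processed and
counter, so that moving to either auxiliary stack and dropping share one proof. The costliest
symbol, a pair, takes 5 steps. -/
lemma readLoop_runs {P : Γ' → Frag} {g : List Γ' → List Γ' → List Γ' → Stacks}
    (hP : ∀ x m y c, (P x).Runs (g m y c) (g m (x :: y) c) 1)
    (hm : ∀ m y c, g m y c .main = m) (hm' : ∀ m y c m', update (g m y c) .main m' = g m' y c)
    (hc : ∀ m y c, g m y c .c = c) (hc' : ∀ m y c c', update (g m y c) .c c' = g m y c')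
    (t : BinTree) (m y c : List Γ') (x : Γ') (S : Stacks) (T : ℕ)
    (h : (readLoop P).Runs (g m (t.code.reverse ++ y) c) S T) :
    (readLoop P).Runs (g (t.code ++ m) y (x :: c)) S (T + 5 * t.size) := by
  induction t generalizing m y c x T with
  | nil =>
    have h1 : (readSymbol P).Runs (g (nil.code ++ m) y c) (g m (.bit false :: y) c) 2 :=
      sw_runs_stop (x := Γ'.bit false) (r := m) (hm _ _ _) rfl (hm' _ _ _ _) (hP _ _ _ _)
    refine Runs.mono (sw_runs_again (x := x) (r := c) (hc _ _ _) rfl (hc' _ _ _ _) h1 h) ?_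
    simp only [size]
    omega
  | cons t u ht hu =>
    have h0 (c : List Γ') : (push .c (.bit true)).Runs (g (t.code ++ (u.code ++ m)) (.bit true :: y) c)
        (g (t.code ++ (u.code ++ m)) (.bit true :: y) (.bit true :: c)) 1 := by
      have := push_runs .c (.bit true) (g (t.code ++ (u.code ++ m)) (.bit true :: y) c)
      rwa [hc, hc'] at this
    have h1 : (readSymbol P).Runs (g ((cons t u).code ++ m) y c)
        (g (t.code ++ (u.code ++ m)) (.bit true :: y) (.bit true :: .bit true :: c)) 4 :=
      sw_runs_stop (x := Γ'.bit true) (r := t.code ++ (u.code ++ m)) (by rw [hm]; simp [code]) rfl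
        (hm' _ _ _ _) ((hP _ _ _ _).seq ((h0 c).seq (h0 (.bit true :: c))))
    -- The two counter symbols just pushed pay for `t` and then for `u`.
    have h2 := ht (u.code ++ m) (.bit true :: y) (.bit true :: c) (.bit true) _
      (hu m (t.code.reverse ++ .bit true :: y) c (.bit true) T (by simpa [code] using h))
    refine Runs.mono (sw_runs_again (x := x) (r := c) (hc _ _ _) rfl (hc' _ _ _ _) h1 h2) ?_
    simp only [size]
    omega

/-- Move a tree from the main stack to stack `a`, reversing its code. -/
def moveA : Frag := (push .c (.bit true)).seq (readLoop fun x => push .a x)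

/-- Move a tree from the main stack to stack `b`, reversing its code. -/
def moveB : Frag := (push .c (.bit true)).seq (readLoop fun x => push .b x)

/-- Remove a tree from the main stack. -/
def drop : Frag := (push .c (.bit true)).seq (readLoop fun _ => skip)

variable (i m a b : List Γ') (t : BinTree)

lemma moveA_runs : moveA.Runs (stk i (t.code ++ m) a b [])
    (stk i m (t.code.reverse ++ a) b []) (5 * t.size + 2) := by
  have := readLoop_runs (P := fun x => push .a x) (g := fun m y c => stk i m y b c)
    (fun x m y c => by simpa using push_runs .a x (stk i m y b c)) (by simp) (by simp) (by simp)
    (by simp) t m a [] (.bit true) _ 1 (sw_runs_nil (by simp))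
  refine ((push_runs .c (.bit true) _).seq (T := 1) (T' := 1 + 5 * t.size) ?_).mono (by omega)
  simpa using this

lemma moveB_runs : moveB.Runs (stk i (t.code ++ m) a b [])
    (stk i m a (t.code.reverse ++ b) []) (5 * t.size + 2) := by
  have := readLoop_runs (P := fun x => push .b x) (g := fun m y c => stk i m a y c)
    (fun x m y c => by simpa using push_runs .b x (stk i m a y c)) (by simp) (by simp) (by simp)
    (by simp) t m b [] (.bit true) _ 1 (sw_runs_nil (by simp))
  refine ((push_runs .c (.bit true) _).seq (T := 1) (T' := 1 + 5 * t.size) ?_).mono (by omega)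
  simpa using this

lemma drop_runs : drop.Runs (stk i (t.code ++ m) a b []) (stk i m a b []) (5 * t.size + 2) := by
  have := readLoop_runs (P := fun _ => skip) (g := fun m _ c => stk i m a b c)
    (fun x m y c => skip_runs _) (by simp) (by simp) (by simp)
    (by simp) t m [] [] (.bit true) _ 1 (sw_runs_nil (by simp))
  refine ((push_runs .c (.bit true) _).seq (T := 1) (T' := 1 + 5 * t.size) ?_).mono (by omega)
  simpa using this

/-- Move the contents of stack `a` to the main stack. -/
def unloadA : Frag := sw .a (fun x => push .main x) (fun _ => true)

/-- Move the contents of stack `b` to the main stack. -/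
def unloadB : Frag := sw .b (fun x => push .main x) (fun _ => true)

lemma unloadA_runs : unloadA.Runs (stk i m a b []) (stk i (a.reverse ++ m) [] b [])
    (2 * a.length + 1) := by
  induction a generalizing m with
  | nil => simpa [unloadA] using sw_runs_nil (by simp)
  | cons x a ih =>
    refine (sw_runs_again (x := x) (r := a) (by simp) rfl (by simp; rfl) (push_runs .main x _) (T' := _) ?_).mono
      (T := 1 + (2 * a.length + 1) + 1) (by simp; omega)
    simpa [unloadA] using ih (x :: m)

lemma unloadB_runs : unloadB.Runs (stk i m a b []) (stk i (b.reverse ++ m) a [] [])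
    (2 * b.length + 1) := by
  induction b generalizing m with
  | nil => simpa [unloadB] using sw_runs_nil (by simp)
  | cons x b ih =>
    refine (sw_runs_again (x := x) (r := b) (by simp) rfl (by simp; rfl) (push_runs .main x _) (T' := _) ?_).mono
      (T := 1 + (2 * b.length + 1) + 1) (by simp; omega)
    simpa [unloadB] using ih (x :: m)

/-- Copy the contents of stack `a` to the main stack and to stack `b`. -/
def copyA : Frag := sw .a (fun x => (push .main x).seq (push .b x)) (fun _ => true)

lemma copyA_runs : copyA.Runs (stk i m a b []) (stk i (a.reverse ++ m) [] (a.reverse ++ b) [])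
    (3 * a.length + 1) := by
  induction a generalizing m b with
  | nil => simpa [copyA] using sw_runs_nil (by simp)
  | cons x a ih =>
    refine (sw_runs_again (x := x) (r := a) (by simp) rfl (by simp; rfl)
      ((push_runs .main x _).seq (push_runs .b x _)) (T' := _) ?_).mono
      (T := (1 + 1) + (3 * a.length + 1) + 1) (by simp; omega)
    simpa [copyA] using ih (x :: m) (x :: b)

/-- Move the contents of stack `b` to stack `a`. -/
def moveBA : Frag := sw .b (fun x => push .a x) (fun _ => true)

lemma moveBA_runs : moveBA.Runs (stk i m a b []) (stk i m (b.reverse ++ a) [] [])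
    (2 * b.length + 1) := by
  induction b generalizing a with
  | nil => simpa [moveBA] using sw_runs_nil (by simp)
  | cons x b ih =>
    refine (sw_runs_again (x := x) (r := b) (by simp) rfl (by simp; rfl) (push_runs .a x _) (T' := _) ?_).mono
      (T := 1 + (2 * b.length + 1) + 1) (by simp; omega)
    simpa [moveBA] using ih (x :: a)

/-- Duplicate the tree on top of the main stack. -/
def dup : Frag := moveA.seq (copyA.seq (moveBA.seq unloadA))

lemma dup_runs : dup.Runs (onMain (t.code ++ m)) (onMain (t.code ++ (t.code ++ m)))
    (12 * t.size + 5) := by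
  have h1 := moveA_runs [] m [] [] t
  have h2 := copyA_runs [] m (t.code.reverse ++ []) []
  have h3 := moveBA_runs [] (t.code ++ m) [] t.code
  have h4 := unloadA_runs [] (t.code ++ m) (t.code.reverse) []
  simp only [List.append_nil, List.reverse_reverse, List.length_reverse, length_code] at h1 h2 h3 h4
  exact (h1.seq (h2.seq (h3.seq h4))).mono (by omega)

/-- Exchange the two topmost trees of the main stack. -/
def swap : Frag := moveA.seq (moveB.seq (unloadA.seq unloadB))

lemma swap_runs (u : BinTree) : swap.Runs (onMain (t.code ++ (u.code ++ m)))
    (onMain (u.code ++ (t.code ++ m))) (7 * t.size + 7 * u.size + 6) := by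
  have h1 := moveA_runs [] (u.code ++ m) [] [] t
  have h2 := moveB_runs [] m t.code.reverse [] u
  have h3 := unloadA_runs [] m t.code.reverse u.code.reverse
  have h4 := unloadB_runs [] (t.code ++ m) [] u.code.reverse
  simp only [List.append_nil, List.reverse_reverse, List.length_reverse, length_code] at h1 h2 h3 h4
  exact (h1.seq (h2.seq (h3.seq h4))).mono (by omega)

/-- Push a word. -/
def pushWord : List Γ' → Frag
  | [] => skip
  | x :: w => (pushWord w).seq (push .main x)

lemma pushWord_runs (w : List Γ') : (pushWord w).Runs (stk i m a b []) (stk i (w ++ m) a b [])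
    (w.length + 1) := by
  induction w with
  | nil => exact skip_runs _
  | cons x w ih => simpa [pushWord] using ih.seq (push_runs .main x _)

/-- Replace the pair on top of the main stack by its first component. -/
def head : Frag :=
  sw .main (fun x => match x with
    | .bit true => moveA.seq (drop.seq unloadA)
    | x => push .main x) (fun _ => false)

/-- Replace the pair on top of the main stack by its second component. -/
def tail : Frag :=
  sw .main (fun x => match x with
    | .bit true => drop
    | x => push .main x) (fun _ => false)

lemma head_runs_cons (u : BinTree) : head.Runs (onMain ((cons t u).code ++ m))
    (onMain (t.code ++ m)) (7 * (cons t u).size) := by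
  have h1 := moveA_runs [] (u.code ++ m) [] [] t
  have h2 := drop_runs [] m t.code.reverse [] u
  have h3 := unloadA_runs [] m t.code.reverse []
  simp only [List.append_nil, List.reverse_reverse, List.length_reverse, length_code] at h1 h2 h3
  refine (sw_runs_stop (x := Γ'.bit true) (r := t.code ++ (u.code ++ m)) (by simp [code]) rfl (by simp)
    (h1.seq (h2.seq h3))).mono ?_
  simp only [size]
  omega

lemma tail_runs_cons (u : BinTree) : tail.Runs (onMain ((cons t u).code ++ m))
    (onMain (u.code ++ m)) (7 * (cons t u).size) := by
  refine (sw_runs_stop (x := Γ'.bit true) (r := t.code ++ (u.code ++ m)) (by simp [code]) rfl (by simp)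
    (drop_runs [] (u.code ++ m) [] [] t)).mono ?_
  simp only [size]
  omega

/-- Remove the tree on top of the main stack, and run `F` if it is a pair and `G` if it is `nil`. -/
def ite (F G : Frag) : Frag :=
  sw .main (fun x => match x with
    | .bit true => drop.seq (drop.seq F)
    | _ => G) (fun _ => false)

variable {F G : Frag} {S : Stacks} {T : ℕ}

lemma ite_runs_cons (u : BinTree) (h : F.Runs (onMain m) S T) :
    (ite F G).Runs (onMain ((cons t u).code ++ m)) S (T + 5 * (cons t u).size) := by
  refine (sw_runs_stop (x := Γ'.bit true) (r := t.code ++ (u.code ++ m)) (by simp [code]) rfl (by simp)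
    ((drop_runs [] (u.code ++ m) [] [] t).seq ((drop_runs [] m [] [] u).seq h))).mono ?_
  simp only [size]
  omega

lemma ite_runs_nil (h : G.Runs (onMain m) S T) :
    (ite F G).Runs (onMain (nil.code ++ m)) S (T + 1) :=
  sw_runs_stop (x := Γ'.bit false) (r := m) (by simp [code]) rfl (by simp) h

/-- The main stack holds a list, followed by a state. Run `F` on each element of the list, paired
with the state. -/
def foldLoop (F : Frag) : Frag :=
  sw .main (fun x => match x with
    | .bit true => moveA.seq (moveB.seq (moveA.seq (unloadB.seq (unloadA.seq
        ((push .main (.bit true)).seq (F.seq swap))))))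
    | _ => skip) (fun x => decide (x = .bit true))

lemma foldLoop_runs_nil (h : t.code = nil.code) (s : BinTree) :
    (foldLoop F).Runs (onMain (t.code ++ (s.code ++ m))) (onMain (s.code ++ m)) 2 := by
  rw [h]
  exact sw_runs_stop (x := Γ'.bit false) (r := s.code ++ m) (by simp [code]) (by decide) (by simp)
    (skip_runs _)

/-- Element and state go to stack `a`, the rest of the list to stack `b`; unloading `b` first puts
the pair of element and state above the rest of the list. After `F`, a swap restores the order of
list and state. -/
lemma foldLoop_runs_cons {x l s s' : BinTree} {T' : ℕ}
    (hF : F.Runs (onMain ((cons x s).code ++ (l.code ++ m)))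
      (onMain (s'.code ++ (l.code ++ m))) T')
    (h : (foldLoop F).Runs (onMain (l.code ++ (s'.code ++ m))) S T) :
    (foldLoop F).Runs (onMain ((cons x l).code ++ (s.code ++ m))) S
      (T + (T' + 7 * s'.size + 7 * s.size + 14 * (cons x l).size + 13)) := by
  have h1 := moveA_runs [] (l.code ++ (s.code ++ m)) [] [] x
  have h2 := moveB_runs [] (s.code ++ m) x.code.reverse [] l
  have h3 := moveA_runs [] m x.code.reverse l.code.reverse s
  have h4 := unloadB_runs [] m (s.code.reverse ++ x.code.reverse) l.code.reverse
  have h5 := unloadA_runs [] (l.code ++ m) (s.code.reverse ++ x.code.reverse) []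
  have h6 := push_runs .main (.bit true) (onMain (x.code ++ (s.code ++ (l.code ++ m))))
  have h7 := swap_runs m s' l
  simp only [List.append_nil, List.reverse_reverse, List.length_reverse, length_code,
    List.length_append, List.reverse_append, List.append_assoc, stk_main, update_main]
    at h1 h2 h3 h4 h5 h6 h7
  simp only [code, List.cons_append, List.append_assoc] at hF
  refine (sw_runs_again (x := Γ'.bit true) (r := x.code ++ (l.code ++ (s.code ++ m)))
    (by simp [code]) (by decide) (by simp)
    (h1.seq (h2.seq (h3.seq (h4.seq (h5.seq (h6.seq (hF.seq h7))))))) h).mono ?_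
  simp only [size]
  omega

end Frag

end StackProgram

/-! ### Polynomial-time functions on tree-coded data. -/

namespace StackProgram

open BinTree

lemma eval_mono (p : Polynomial ℕ) {m n : ℕ} (h : m ≤ n) : p.eval m ≤ p.eval n := by
  rw [Polynomial.eval_eq_sum_range, Polynomial.eval_eq_sum_range]
  gcongr

/-- Types whose elements are represented by trees. -/
class Enc (α : Type) where
  /-- the tree that represents an element -/
  enc : α → BinTree

/-- The size of the tree that represents an element. -/
def sz {α : Type} [Enc α] (a : α) : ℕ := (Enc.enc a).size

open Enc (enc)

instance : Enc Unit := ⟨fun _ => .nil⟩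

instance : Enc Bool := ⟨fun b => bif b then .cons .nil .nil else .nil⟩

instance {α β : Type} [Enc α] [Enc β] : Enc (α × β) := ⟨fun x => .cons (enc x.1) (enc x.2)⟩

instance {α : Type} [Enc α] : Enc (List α) := ⟨List.foldr (fun a t => .cons (enc a) t) .nil⟩

/-- Natural numbers are coded in unary. This is affordable for counters, vertex numbers and flows
only; costs, budget and bound stay lists of binary digits. -/
instance : Enc ℕ := ⟨fun n => enc (List.replicate n ())⟩

/-- The proof component leaves no trace in the code, so the branches of a case distinction can be
treated as functions on subtypes at no cost. -/
instance {α : Type} [Enc α] {p : α → Prop} : Enc {a // p a} := ⟨fun a => enc a.1⟩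

section size

variable {α β : Type} [Enc α] [Enc β]

lemma sz_pos (a : α) : 1 ≤ sz a := size_pos _

@[simp] lemma sz_unit (a : Unit) : sz a = 1 := rfl

lemma sz_bool (b : Bool) : sz b ≤ 3 := by cases b <;> simp [sz, enc, size]

@[simp] lemma sz_prod (x : α × β) : sz x = sz x.1 + sz x.2 + 1 := rfl

@[simp] lemma sz_nil : sz ([] : List α) = 1 := rfl

@[simp] lemma sz_cons (a : α) (l : List α) : sz (a :: l) = sz a + sz l + 1 := rfl

@[simp] lemma sz_subtype {p : α → Prop} (a : {a // p a}) : sz a = sz a.1 := rfl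

lemma sz_list (l : List α) : sz l = (l.map sz).sum + l.length + 1 := by
  induction l with
  | nil => rfl
  | cons a l ih => simp [ih]; omega

@[simp] lemma sz_nat (n : ℕ) : sz n = 2 * n + 1 := by
  change sz (List.replicate n ()) = _
  rw [sz_list]
  simp
  omega

lemma length_le_sz (l : List α) : l.length ≤ sz l := by rw [sz_list]; omega

lemma sz_le_of_mem {a : α} {l : List α} (h : a ∈ l) : sz a ≤ sz l := by
  have := List.single_le_sum (l := l.map sz) (by simp) (sz a) (List.mem_map_of_mem h)
  rw [sz_list]
  omega

lemma sz_list_le {l : List α} {B : ℕ} (h : ∀ a ∈ l, sz a ≤ B) : sz l ≤ l.length * (B + 1) + 1 := by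
  induction l with
  | nil => simp
  | cons a l ih =>
    have h1 := h a (by simp)
    have h2 := ih fun b hb => h b (by simp [hb])
    simp only [sz_cons, List.length_cons]
    linarith

end size

/-- Functions computed by a piece of machine in polynomial time. -/
@[fun_prop]
def PolyFn {α β : Type} [Enc α] [Enc β] (f : α → β) : Prop :=
  ∃ (F : Frag) (p : Polynomial ℕ), ∀ a, sz (f a) ≤ p.eval (sz a) ∧
    ∀ m, F.Runs (onMain ((enc a).code ++ m)) (onMain ((enc (f a)).code ++ m)) (p.eval (sz a))

namespace PolyFn

variable {α β γ δ : Type} [Enc α] [Enc β] [Enc γ] [Enc δ]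

/-- A machine sees only the trees, so functions with equal codes are interchangeable, even between
different types. -/
lemma of_enc_eq {f : α → β} {g : α → γ} (hf : PolyFn f) (h : ∀ a, enc (f a) = enc (g a)) :
    PolyFn g := by
  obtain ⟨F, p, hF⟩ := hf
  refine ⟨F, p, fun a => ?_⟩
  have := hF a
  rw [sz, h] at this
  exact this

@[fun_prop]
lemma id : PolyFn (fun a : α => a) :=
  ⟨.skip, Polynomial.X, fun a => ⟨by simp, fun m => (Frag.skip_runs _).mono (by simp [sz_pos])⟩⟩

@[fun_prop]
lemma comp {f : β → γ} {g : α → β} (hf : PolyFn f) (hg : PolyFn g) : PolyFn (fun a => f (g a)) := by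
  obtain ⟨F, p, hF⟩ := hf
  obtain ⟨G, q, hG⟩ := hg
  refine ⟨G.seq F, q + p.comp q, fun a => ⟨?_, fun m => ?_⟩⟩
  · have := eval_mono p (hG a).1
    simp only [Polynomial.eval_add, Polynomial.eval_comp]
    have := (hF (g a)).1
    omega
  · refine (((hG a).2 m).seq ((hF (g a)).2 m)).mono ?_
    simp only [Polynomial.eval_add, Polynomial.eval_comp]
    have := eval_mono p (hG a).1
    omega

@[fun_prop]
lemma const (b : β) : PolyFn (fun _ : α => b) := by
  refine ⟨Frag.drop.seq (Frag.pushWord (enc b).code),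
    5 * Polynomial.X + 2 + (Polynomial.C (sz b) + 1), fun a => ⟨?_, fun m => ?_⟩⟩
  · simp; omega
  · refine ((Frag.drop_runs [] m [] [] (enc a)).seq
      (Frag.pushWord_runs [] m [] [] (enc b).code)).mono ?_
    simp [length_code, sz]

lemma cons_of {f : α → β} {g : α → γ} {k : α → δ} (hf : PolyFn f) (hg : PolyFn g)
    (h : ∀ a, enc (k a) = .cons (enc (f a)) (enc (g a))) : PolyFn k := by
  obtain ⟨F, p, hF⟩ := hf
  obtain ⟨G, q, hG⟩ := hg
  refine ⟨Frag.dup.seq (G.seq (Frag.swap.seq (F.seq (.push .main (.bit true))))),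
    -- Duplication costs 12·X + 5, the swap 7·X + 7·q + 6, the two computations q and p, and the
    -- last push 1.
    19 * Polynomial.X + 8 * q + p + 12, fun a => ⟨?_, fun m => ?_⟩⟩
  · have h1 := (hF a).1
    have h2 := (hG a).1
    simp [sz, h, size] at *
    omega
  · have h1 := Frag.dup_runs m (enc a)
    have h2 := (hG a).2 ((enc a).code ++ m)
    have h3 := Frag.swap_runs m (enc (g a)) (enc a)
    have h4 := (hF a).2 ((enc (g a)).code ++ m)
    have h5 := Frag.push_runs .main (.bit true)
      (onMain ((enc (f a)).code ++ ((enc (g a)).code ++ m)))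
    simp only [stk_main, update_main] at h5
    have h6 := (hG a).1
    rw [h]
    simp only [code, List.cons_append, List.append_assoc]
    refine (h1.seq (h2.seq (h3.seq (h4.seq h5)))).mono ?_
    simp [sz] at *
    omega

/-- Stated for trees rather than for pairs, so that it serves both first components and heads of
nonempty lists. -/
lemma head_of {f : α → β} {g : α → γ} (hf : PolyFn f)
    (h : ∀ a, ∃ y, enc (f a) = .cons (enc (g a)) y) : PolyFn g := by
  obtain ⟨F, p, hF⟩ := hf
  refine ⟨F.seq .head, 8 * p, fun a => ?_⟩
  obtain ⟨y, hy⟩ := h a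
  have h1 := (hF a).1
  rw [sz, hy] at h1
  refine ⟨?_, fun m => ?_⟩
  · simp [sz, size] at *
    omega
  · have h2 := (hF a).2 m
    rw [hy] at h2
    refine (h2.seq (Frag.head_runs_cons m _ _)).mono ?_
    simp
    omega

lemma tail_of {f : α → β} {g : α → γ} (hf : PolyFn f)
    (h : ∀ a, ∃ x, enc (f a) = .cons x (enc (g a))) : PolyFn g := by
  obtain ⟨F, p, hF⟩ := hf
  refine ⟨F.seq .tail, 8 * p, fun a => ?_⟩
  obtain ⟨y, hy⟩ := h a
  have h1 := (hF a).1
  rw [sz, hy] at h1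
  refine ⟨?_, fun m => ?_⟩
  · simp [sz, size] at *
    omega
  · have h2 := (hF a).2 m
    rw [hy] at h2
    refine (h2.seq (Frag.tail_runs_cons m _ _)).mono ?_
    simp
    omega

@[fun_prop]
lemma prodMk {f : α → β} {g : α → γ} (hf : PolyFn f) (hg : PolyFn g) :
    PolyFn (fun a => (f a, g a)) := hf.cons_of hg fun _ => rfl

@[fun_prop]
lemma fst {f : α → β × γ} (hf : PolyFn f) : PolyFn (fun a => (f a).1) :=
  hf.head_of fun _ => ⟨_, rfl⟩

@[fun_prop]
lemma snd {f : α → β × γ} (hf : PolyFn f) : PolyFn (fun a => (f a).2) :=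
  hf.tail_of fun _ => ⟨_, rfl⟩

@[fun_prop]
lemma cons {f : α → β} {g : α → List β} (hf : PolyFn f) (hg : PolyFn g) :
    PolyFn (fun a => f a :: g a) := hf.cons_of hg fun _ => rfl

@[fun_prop]
lemma succ {f : α → ℕ} (hf : PolyFn f) : PolyFn (fun a => f a + 1) :=
  (const (α := α) ()).cons_of hf fun _ => rfl

@[fun_prop]
lemma val {p : β → Prop} {f : α → {b // p b}} (hf : PolyFn f) : PolyFn (fun a => (f a).1) :=
  hf.of_enc_eq fun _ => rfl

lemma restrict {f : α → β} (hf : PolyFn f) (p : α → Prop) : PolyFn (fun a : {a // p a} => f a.1) :=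
  hf.comp (val id)

/-- Definition by cases according to whether the value of a function is represented by `nil`. -/
lemma cases_of {f : α → β} {k : α → γ} (p : α → Prop) (hf : PolyFn f)
    (hp : ∀ a, p a → ∃ x y, enc (f a) = .cons x y) (hn : ∀ a, ¬ p a → enc (f a) = .nil)
    (h₁ : PolyFn fun a : {a // p a} => k a.1) (h₂ : PolyFn fun a : {a // ¬ p a} => k a.1) :
    PolyFn k := by
  obtain ⟨G, q, hG⟩ := h₁
  obtain ⟨H, r, hH⟩ := h₂
  obtain ⟨F, p', hF⟩ := hf
  refine ⟨Frag.dup.seq (F.seq (Frag.ite G H)), 12 * Polynomial.X + 6 * p' + q + r + 6,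
    fun a => ⟨?_, fun m => ?_⟩⟩
  · by_cases ha : p a
    · have := (hG ⟨a, ha⟩).1
      simp at *
      omega
    · have := (hH ⟨a, ha⟩).1
      simp at *
      omega
  · have h1 := Frag.dup_runs m (enc a)
    have h2 := (hF a).2 ((enc a).code ++ m)
    have h3 := (hF a).1
    by_cases ha : p a
    · obtain ⟨x, y, hxy⟩ := hp a ha
      have h4 : (Frag.ite G H).Runs _ (onMain ((enc (k a)).code ++ m))
        (q.eval (enc a).size + _) :=
        Frag.ite_runs_cons ((enc a).code ++ m) x y (G := H) ((hG ⟨a, ha⟩).2 m)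
      rw [← hxy] at h4
      refine (h1.seq (h2.seq h4)).mono ?_
      simp [sz] at *
      omega
    · have h4 : (Frag.ite G H).Runs _ (onMain ((enc (k a)).code ++ m)) (r.eval (enc a).size + 1) :=
        Frag.ite_runs_nil ((enc a).code ++ m) (F := G) ((hH ⟨a, ha⟩).2 m)
      rw [← hn a ha] at h4
      refine (h1.seq (h2.seq h4)).mono ?_
      simp [sz] at *
      omega

lemma ite_of {c : α → Bool} {k : α → γ} (hc : PolyFn c)
    (h₁ : PolyFn fun a : {a // c a = true} => k a.1)
    (h₂ : PolyFn fun a : {a // ¬ c a = true} => k a.1) : PolyFn k :=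
  cases_of (fun a => c a = true) hc (fun a h => ⟨.nil, .nil, by rw [h]; rfl⟩)
    (fun a h => by rw [Bool.not_eq_true] at h; rw [h]; rfl) h₁ h₂

@[fun_prop]
lemma ite {c : α → Bool} {f g : α → γ} (hc : PolyFn c) (hf : PolyFn f) (hg : PolyFn g) :
    PolyFn (fun a => if c a = true then f a else g a) :=
  ite_of hc ((hf.restrict _).of_enc_eq fun a => by simp [a.2])
    ((hg.restrict _).of_enc_eq fun a => by simp [a.2])

/-- Handles functions defined by matching on a list; `k` is given by its two equations, so that it
can be any such definition. -/
lemma list_cases {f : α → List β} {g : α → γ} {h : α → β → List β → γ} {k : α → γ}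
    (hf : PolyFn f) (hg : PolyFn g) (hh : PolyFn fun x : α × β × List β => h x.1 x.2.1 x.2.2)
    (h₁ : ∀ a, f a = [] → k a = g a) (h₂ : ∀ a b l, f a = b :: l → k a = h a b l) : PolyFn k := by
  refine cases_of (fun a => f a ≠ []) hf (fun a ha => ?_) (fun a ha => ?_) ?_ ?_
  · obtain ⟨b, l, hl⟩ := List.exists_cons_of_ne_nil ha
    exact ⟨enc b, enc l, by rw [hl]; rfl⟩
  · rw [not_not] at ha
    rw [ha]
    rfl
  · have h3 : PolyFn fun a : {a // f a ≠ []} => (f a.1).head a.2 :=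
      (hf.restrict _).head_of fun a => ⟨enc (f a.1).tail, by
        obtain ⟨b, l, hl⟩ := List.exists_cons_of_ne_nil a.2
        simp [hl]; rfl⟩
    have h4 : PolyFn fun a : {a // f a ≠ []} => (f a.1).tail :=
      (hf.restrict _).tail_of fun a => ⟨enc ((f a.1).head a.2), by
        obtain ⟨b, l, hl⟩ := List.exists_cons_of_ne_nil a.2
        simp [hl]; rfl⟩
    refine (hh.comp (prodMk (val id) (prodMk h3 h4))).of_enc_eq fun a => ?_
    obtain ⟨b, l, hl⟩ := List.exists_cons_of_ne_nil a.2
    simp [hl, h₂ _ _ _ hl]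
  · refine (hg.restrict _).of_enc_eq fun a => ?_
    rw [h₁ _ (not_not.1 a.2)]

/-- Iteration along a list, if the intermediate results are of polynomial size. -/
lemma foldl_aux {L : α → List β} {s : α → γ} {g : γ → β → γ} (hL : PolyFn L) (hs : PolyFn s)
    (hg : PolyFn fun x : β × γ => g x.2 x.1) (q : Polynomial ℕ)
    (hq : ∀ a l', l' <+: L a → sz (l'.foldl g (s a)) ≤ q.eval (sz a)) :
    PolyFn (fun a => (L a).foldl g (s a)) := by
  obtain ⟨G, r, hG⟩ := hg
  -- `Z` bounds the list and `B` every intermediate state, so each round has the same cost bound and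
  -- the total is linear in the number of rounds.
  have key (Z B : ℕ) (l : List β) (c : γ) (m : List Γ') (hZ : sz l ≤ Z)
      (hB : ∀ l', l' <+: l → sz (l'.foldl g c) ≤ B) :
      (Frag.foldLoop G).Runs (onMain ((enc l).code ++ ((enc c).code ++ m)))
        (onMain ((enc (l.foldl g c)).code ++ m))
        (l.length * (r.eval (Z + B + 1) + 14 * B + 14 * Z + 13) + 2) := by
    induction l generalizing c with
    | nil => exact (Frag.foldLoop_runs_nil m _ rfl _).mono (by simp)
    | cons b l ih =>
      have h0 := hB [] (by simp)
      have h1 := hB [b] (by simp)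
      have h2 := (hG (b, c)).2 ((enc l).code ++ m)
      have h3 := ih (g c b) (by simp at hZ; omega)
        fun l' hl' => hB (b :: l') ((List.prefix_cons_inj b).2 hl')
      refine (Frag.foldLoop_runs_cons m h2 h3).mono ?_
      have h4 : r.eval (sz (b, c)) ≤ r.eval (Z + B + 1) :=
        eval_mono r (by simp at *; omega)
      have h5 : (BinTree.cons (enc b) (enc l)).size ≤ Z := hZ
      simp only [List.foldl_nil, List.foldl_cons, List.length_cons] at *
      simp only [sz] at *
      linarith
  obtain ⟨F, p, hF⟩ := prodMk hL hs
  -- The switch in the middle removes the leading symbol of the pair, leaving the list followed by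
  -- the state, as `foldLoop` expects.
  refine ⟨F.seq ((Frag.sw .main (fun _ => .skip) (fun _ => false)).seq (Frag.foldLoop G)),
    q + p + (p * (r.comp (p + q + 1) + 14 * q + 14 * p + 13) + 4), fun a => ⟨?_, fun m => ?_⟩⟩
  · have := hq a (L a) List.prefix_rfl
    simp
    omega
  · have h1 := (hF a).2 m
    have h2 := (hF a).1
    have h3 : (Frag.sw .main (fun _ => .skip) (fun _ => false)).Runs
        (onMain ((enc (L a, s a)).code ++ m))
        (onMain ((enc (L a)).code ++ ((enc (s a)).code ++ m))) 2 :=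
      Frag.sw_runs_stop (x := Γ'.bit true) (r := (enc (L a)).code ++ ((enc (s a)).code ++ m))
        (by simp [enc, code]) rfl (by simp) (Frag.skip_runs _)
    have h4 := key (p.eval (sz a)) (q.eval (sz a)) (L a) (s a) m (by simp at h2; omega) (hq a)
    refine (h1.seq (h3.seq h4)).mono ?_
    have h5 : (L a).length ≤ p.eval (sz a) := by
      have := length_le_sz (L a)
      simp at h2
      omega
    have := Nat.mul_le_mul_right
      (r.eval (p.eval (sz a) + q.eval (sz a) + 1) + 14 * q.eval (sz a) + 14 * p.eval (sz a) + 13) h5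
    simp only [Polynomial.eval_add, Polynomial.eval_mul, Polynomial.eval_comp,
      Polynomial.eval_one, Polynomial.eval_ofNat]
    omega

/-- A step function that depends on the input reduces to `foldl_aux` by carrying the input along as
an unchanged part of the state. -/
lemma foldl {L : α → List β} {s : α → γ} {g : α → γ → β → γ} (hL : PolyFn L) (hs : PolyFn s)
    (hg : PolyFn fun x : α × γ × β => g x.1 x.2.1 x.2.2) (q : Polynomial ℕ)
    (hq : ∀ a l', l' <+: L a → sz (l'.foldl (g a) (s a)) ≤ q.eval (sz a)) :
    PolyFn (fun a => (L a).foldl (g a) (s a)) := by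
  have key (a : α) (l : List β) (c : γ) :
      l.foldl (fun (y : α × γ) b => (y.1, g y.1 y.2 b)) (a, c) = (a, l.foldl (g a) c) := by
    induction l generalizing c with
    | nil => rfl
    | cons b l ih => simp [ih]
  have := foldl_aux (L := L) (s := fun a => (a, s a))
    (g := fun (y : α × γ) b => (y.1, g y.1 y.2 b)) hL (by fun_prop)
    (prodMk (by fun_prop) (hg.comp (g := fun x : β × α × γ => (x.2.1, x.2.2, x.1)) (by fun_prop)))
    (Polynomial.X + q + 1) (fun a l' hl' => by
      have := hq a l' hl'
      simp [key]
      omega)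
  exact this.snd.of_enc_eq fun a => by rw [key]

end PolyFn

end StackProgram

/-! ### List operations and unary arithmetic in polynomial time. -/

namespace StackProgram

open Enc (enc)

section size

variable {α β : Type} [Enc α] [Enc β]

lemma sz_append (l l' : List α) : sz (l ++ l') + 1 = sz l + sz l' := by
  simp only [sz_list, List.map_append, List.sum_append, List.length_append]
  omega

@[simp] lemma sz_reverse (l : List α) : sz l.reverse = sz l := by
  simp [sz_list, List.sum_reverse]

lemma sz_le_of_sublist {l l' : List α} (h : l.Sublist l') : sz l ≤ sz l' := by
  induction h with
  | slnil => rfl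
  | cons a _ ih => simp; omega
  | cons_cons a _ ih => simpa

lemma sz_flatMap_le {α : Type} {l : List α} {f : α → List β} {B : ℕ} (h : ∀ a ∈ l, sz (f a) ≤ B) :
    sz (l.flatMap f) ≤ l.length * B + 1 := by
  induction l with
  | nil => simp
  | cons a l ih =>
    have h1 := h a (by simp)
    have h2 := ih fun b hb => h b (by simp [hb])
    have h3 := sz_append (f a) (l.flatMap f)
    simp only [List.flatMap_cons, List.length_cons]
    linarith

end size

namespace PolyFn

variable {α β γ δ : Type} [Enc α] [Enc β] [Enc γ] [Enc δ]

@[fun_prop]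
lemma reverse {f : α → List β} (hf : PolyFn f) : PolyFn (fun a => (f a).reverse) := by
  have : PolyFn (List.reverse : List β → List β) := by
    have h := foldl (α := List β) (L := fun a => a) (s := fun _ => ([] : List β))
      (g := fun _ l b => b :: l) (by fun_prop) (by fun_prop) (by fun_prop) Polynomial.X
      (fun a l' hl' => by simpa using sz_le_of_sublist hl'.sublist)
    exact h.of_enc_eq fun a => by simp
  fun_prop

@[fun_prop]
lemma append {f g : α → List β} (hf : PolyFn f) (hg : PolyFn g) :
    PolyFn (fun a => f a ++ g a) := by
  have : PolyFn fun x : List β × List β => x.1 ++ x.2 := by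
    have h := foldl (α := List β × List β) (L := fun a => a.1.reverse) (s := fun a => a.2)
      (g := fun _ l b => b :: l) (by fun_prop) (by fun_prop) (by fun_prop) Polynomial.X
      (fun a l' hl' => by
        have := sz_le_of_sublist hl'.sublist
        have := sz_append l'.reverse a.2
        simp at *
        omega)
    exact h.of_enc_eq fun a => by simp
  exact this.comp (prodMk hf hg)

/-- A fold that appends: every image has size polynomial in the input, so all partial results do
too. `map` and `filter` are special cases. -/
lemma flatMap {L : α → List β} {h : α → β → List γ} (hL : PolyFn L)
    (hh : PolyFn fun x : α × β => h x.1 x.2) : PolyFn (fun a => (L a).flatMap (h a)) := by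
  have key (a : α) (l : List β) (c : List γ) :
      l.foldl (fun s b => s ++ h a b) c = c ++ l.flatMap (h a) := by
    induction l generalizing c with
    | nil => simp
    | cons b l ih => simp [ih]
  have hh' := hh
  have hL' := hL
  obtain ⟨_, p, hp⟩ := hL
  obtain ⟨_, q, hq⟩ := hh
  have := foldl (L := L) (s := fun _ => ([] : List γ)) (g := fun a s b => s ++ h a b) hL'
    (by fun_prop) (append (by fun_prop)
      (hh'.comp (g := fun x : α × List γ × β => (x.1, x.2.2)) (by fun_prop)))
    (p * q.comp (Polynomial.X + p + 1) + 1) (fun a l' hl' => by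
      rw [key, List.nil_append]
      have h1 := (hp a).1
      have h2 : ∀ b ∈ l', sz (h a b) ≤ q.eval (sz a + p.eval (sz a) + 1) := fun b hb =>
        ((hq (a, b)).1).trans (eval_mono q (by
          have := sz_le_of_mem (hl'.subset hb)
          simp
          omega))
      have h3 : l'.length ≤ p.eval (sz a) :=
        hl'.length_le.trans ((length_le_sz _).trans h1)
      refine (sz_flatMap_le h2).trans ?_
      simp only [Polynomial.eval_add, Polynomial.eval_mul, Polynomial.eval_comp,
        Polynomial.eval_one, Polynomial.eval_X]
      gcongr)
  exact this.of_enc_eq fun a => by rw [key, List.nil_append]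

lemma map {L : α → List β} {h : α → β → γ} (hL : PolyFn L)
    (hh : PolyFn fun x : α × β => h x.1 x.2) : PolyFn (fun a => (L a).map (h a)) :=
  (flatMap (h := fun a b => [h a b]) hL (by fun_prop)).of_enc_eq fun _ =>
    congrArg enc (List.map_eq_flatMap ..).symm

lemma filter {L : α → List β} {h : α → β → Bool} (hL : PolyFn L)
    (hh : PolyFn fun x : α × β => h x.1 x.2) : PolyFn (fun a => (L a).filter (h a)) :=
  (flatMap (h := fun a b => if h a b = true then [b] else []) hL (by fun_prop)).of_enc_eq
    fun a => by
      congr 1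
      induction L a with
      | nil => rfl
      | cons b l ih => cases hb : h a b <;> simp [hb, ih]

@[fun_prop]
lemma isEmpty {f : α → List β} (hf : PolyFn f) : PolyFn (fun a => (f a).isEmpty) :=
  list_cases (g := fun _ => true) (h := fun _ _ _ => false) hf (by fun_prop) (by fun_prop)
    (by simp +contextual) (by simp +contextual)

@[fun_prop]
lemma not {f : α → Bool} (hf : PolyFn f) : PolyFn (fun a => !f a) :=
  (ite hf (const false) (const true)).of_enc_eq fun a => by cases f a <;> rfl

@[fun_prop]
lemma and {f g : α → Bool} (hf : PolyFn f) (hg : PolyFn g) : PolyFn (fun a => f a && g a) :=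
  (ite hf hg (const false)).of_enc_eq fun a => by cases f a <;> simp

@[fun_prop]
lemma or {f g : α → Bool} (hf : PolyFn f) (hg : PolyFn g) : PolyFn (fun a => f a || g a) :=
  (ite hf (const true) hg).of_enc_eq fun a => by cases f a <;> simp

@[fun_prop]
lemma xor {f g : α → Bool} (hf : PolyFn f) (hg : PolyFn g) : PolyFn (fun a => f a ^^ g a) :=
  (ite hf (not hg) hg).of_enc_eq fun a => by cases f a <;> simp

lemma all {L : α → List β} {h : α → β → Bool} (hL : PolyFn L)
    (hh : PolyFn fun x : α × β => h x.1 x.2) : PolyFn (fun a => (L a).all (h a)) :=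
  (isEmpty (filter (h := fun a b => !h a b) hL (by fun_prop))).of_enc_eq fun a => by
    congr 1
    rw [Bool.eq_iff_iff]
    simp

@[fun_prop]
lemma tail {f : α → List β} (hf : PolyFn f) : PolyFn (fun a => (f a).tail) :=
  list_cases (g := fun _ => []) (h := fun _ _ l => l) hf (by fun_prop) (by fun_prop)
    (by simp +contextual) (by simp +contextual)

@[fun_prop]
lemma replicate_unit {f : α → ℕ} (hf : PolyFn f) : PolyFn (fun a => List.replicate (f a) ()) :=
  hf.of_enc_eq fun _ => rfl

@[fun_prop]
lemma length {f : α → List β} (hf : PolyFn f) : PolyFn (fun a => (f a).length) :=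
  (map (h := fun _ _ => ()) hf (by fun_prop)).of_enc_eq fun a => by
    rw [List.map_const']
    rfl

@[fun_prop]
lemma drop {f : α → ℕ} {g : α → List β} (hf : PolyFn f) (hg : PolyFn g) :
    PolyFn (fun a => (g a).drop (f a)) := by
  have key (n : ℕ) (l : List β) :
      (List.replicate n ()).foldl (fun l _ => l.tail) l = l.drop n := by
    induction n generalizing l with
    | zero => rfl
    | succ n ih => rw [List.replicate_succ, List.foldl_cons, ih, List.drop_tail]
  have : PolyFn fun x : ℕ × List β => x.2.drop x.1 := by
    have h := foldl (α := ℕ × List β) (L := fun a => List.replicate a.1 ()) (s := fun a => a.2)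
      (g := fun _ l _ => l.tail) (by fun_prop) (by fun_prop) (by fun_prop) Polynomial.X
      (fun a l' hl' => by
        rw [(List.prefix_replicate_iff.1 hl').2, key]
        have := sz_le_of_sublist (List.drop_sublist l'.length a.2)
        simp
        omega)
    exact h.of_enc_eq fun a => by rw [key]
  exact this.comp (prodMk hf hg)

@[fun_prop]
lemma sub {f g : α → ℕ} (hf : PolyFn f) (hg : PolyFn g) : PolyFn (fun a => f a - g a) :=
  (drop hg (replicate_unit hf)).length.of_enc_eq fun a => by simp

@[fun_prop]
lemma ble {f g : α → ℕ} (hf : PolyFn f) (hg : PolyFn g) : PolyFn (fun a => Nat.ble (f a) (g a)) :=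
  (isEmpty (replicate_unit (sub hf hg))).of_enc_eq fun a => by
    congr 1
    rw [Bool.eq_iff_iff]
    simp [Nat.sub_eq_zero_iff_le]

@[fun_prop]
lemma beq {f g : α → ℕ} (hf : PolyFn f) (hg : PolyFn g) : PolyFn (fun a => Nat.beq (f a) (g a)) :=
  (and (ble hf hg) (ble hg hf)).of_enc_eq fun a => by
    congr 1
    rw [Bool.eq_iff_iff]
    simp [Nat.le_antisymm_iff]

@[fun_prop]
lemma range {f : α → ℕ} (hf : PolyFn f) : PolyFn (fun a => List.range (f a)) := by
  have key (n : ℕ) : (List.replicate n ()).foldl (fun l _ => l.length :: l) [] =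
      (List.range n).reverse := by
    induction n with
    | zero => rfl
    | succ n ih => rw [List.replicate_succ', List.foldl_append, ih, List.range_succ]; simp
  have : PolyFn List.range := by
    have h := foldl (α := ℕ) (L := fun a => List.replicate a ()) (s := fun _ => ([] : List ℕ))
      (g := fun _ l _ => l.length :: l) (by fun_prop) (by fun_prop) (by fun_prop)
      (Polynomial.X * (2 * Polynomial.X + 2) + 1)
      (fun a l' hl' => by
        rw [(List.prefix_replicate_iff.1 hl').2, key, sz_reverse]
        have h1 := (List.prefix_replicate_iff.1 hl').1
        have h2 : ∀ b ∈ List.range l'.length, sz b ≤ 2 * a + 1 := fun b hb => by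
          simp at *
          omega
        refine (sz_list_le h2).trans ?_
        simp only [List.length_range, sz_nat, Polynomial.eval_add, Polynomial.eval_mul,
          Polynomial.eval_X, Polynomial.eval_ofNat, Polynomial.eval_one]
        gcongr <;> omega)
    exact h.reverse.of_enc_eq fun a => by rw [key, List.reverse_reverse]
  fun_prop

end PolyFn

/-! ### Binary arithmetic. -/

/-- The number with the given binary digits, the least significant digit first. -/
def bval (l : List Bool) : ℕ := l.foldr (fun b n => b.toNat + 2 * n) 0

@[simp] lemma bval_nil : bval [] = 0 := rfl

@[simp] lemma bval_cons (b : Bool) (l : List Bool) : bval (b :: l) = b.toNat + 2 * bval l := rfl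

lemma bval_append (l l' : List Bool) : bval (l ++ l') = bval l + 2 ^ l.length * bval l' := by
  induction l with
  | nil => simp
  | cons b l ih => simp [ih, pow_succ]; ring

@[simp] lemma bval_replicate_false (n : ℕ) : bval (List.replicate n false) = 0 := by
  induction n with
  | zero => rfl
  | succ n ih => simp [List.replicate_succ, ih]

lemma bval_encodePosNum (n : PosNum) : bval (encodePosNum n) = n := by
  induction n with
  | one => rfl
  | bit0 n ih => simp [encodePosNum, ih, PosNum.cast_bit0]; omega
  | bit1 n ih => simp [encodePosNum, ih, PosNum.cast_bit1]; omega

@[simp] lemma bval_encodeNat (n : ℕ) : bval (encodeNat n) = n := by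
  rw [encodeNat]
  conv_rhs => rw [← Num.to_of_nat n]
  cases (n : Num) with
  | zero => rfl
  | pos n => exact bval_encodePosNum n

/-- Extend a list of digits by zeros to the length of another list. -/
def padTo (x y : List Bool) : List Bool := x ++ (y.drop x.length).map fun _ => false

lemma length_padTo (x y : List Bool) : (padTo x y).length = max x.length y.length := by
  simp [padTo]
  omega

@[simp] lemma bval_padTo (x y : List Bool) : bval (padTo x y) = bval x := by
  simp [padTo, bval_append]

/-- One step of binary addition. The state consists of the remaining digits of the second summand,
the carry, and the digits of the sum in reverse order. -/
def addStep (s : List Bool × Bool × List Bool) (x : Bool) : List Bool × Bool × List Bool :=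
  match s.1 with
  | [] => ([], s.2.1 && x, (s.2.1 ^^ x) :: s.2.2)
  | y :: l => (l, (x && y || s.2.1 && (x || y)), (s.2.1 ^^ (x ^^ y)) :: s.2.2)

/-- Binary addition. -/
def badd (x y : List Bool) : List Bool :=
  (addStep ((padTo x y).foldl addStep (y, false, [])) false).2.2.reverse

/-- The loop invariant: the digits written so far, plus the carry at the next position, represent
the sum of the parts read. The length hypothesis, which `padTo` provides, ensures that no digit of
`y` is left over. -/
lemma foldl_addStep (l y : List Bool) (c : Bool) (o : List Bool) (h : y.length ≤ l.length) :
    (l.foldl addStep (y, c, o)).1 = [] ∧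
      (l.foldl addStep (y, c, o)).2.2.length = o.length + l.length ∧
      bval (l.foldl addStep (y, c, o)).2.2.reverse +
        2 ^ (o.length + l.length) * (l.foldl addStep (y, c, o)).2.1.toNat =
      bval o.reverse + 2 ^ o.length * (bval l + bval y + c.toNat) := by
  induction l generalizing y c o with
  | nil => simp_all
  | cons x l ih =>
    cases y with
    | nil =>
      obtain ⟨h1, h2, h3⟩ := ih [] (c && x) ((c ^^ x) :: o) (by simp)
      refine ⟨h1, by simp [addStep, h2]; omega, ?_⟩
      simp only [List.foldl_cons, addStep, List.length_cons] at h3 ⊢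
      rw [show o.length + (l.length + 1) = o.length + 1 + l.length by ring, h3]
      cases x <;> cases c <;> simp [bval_append, pow_succ] <;> ring
    | cons y z =>
      obtain ⟨h1, h2, h3⟩ := ih z (x && y || c && (x || y)) ((c ^^ (x ^^ y)) :: o)
        (by simpa using h)
      refine ⟨h1, by simp [addStep, h2]; omega, ?_⟩
      simp only [List.foldl_cons, addStep, List.length_cons] at h3 ⊢
      rw [show o.length + (l.length + 1) = o.length + 1 + l.length by ring, h3]
      cases x <;> cases y <;> cases c <;> simp [bval_append, pow_succ] <;> ring

lemma length_badd (x y : List Bool) : (badd x y).length = max x.length y.length + 1 := by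
  obtain ⟨h1, h2, -⟩ := foldl_addStep (padTo x y) y false [] (by simp [length_padTo])
  rw [badd, addStep, h1]
  simp [h2, length_padTo]

@[simp] lemma bval_badd (x y : List Bool) : bval (badd x y) = bval x + bval y := by
  obtain ⟨h1, h2, h3⟩ := foldl_addStep (padTo x y) y false [] (by simp [length_padTo])
  rw [badd, addStep, h1]
  simp [bval_append, h2] at h3 ⊢
  omega

/-- One step of the comparison of binary numbers. The state consists of the remaining digits of the
second number and the result for the digits read so far. -/
def bleStep (s : List Bool × Bool) (x : Bool) : List Bool × Bool :=
  match s.1 with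
  | [] => ([], s.2 && !x)
  | y :: l => (l, if (x ^^ y) = true then y else s.2)

/-- Comparison of binary numbers. -/
def ble (x y : List Bool) : Bool := ((padTo x y).foldl bleStep (y, true)).2

/-- The most significant differing digit decides and is read last, so each differing pair of digits
overrides the earlier verdict. -/
lemma foldl_bleStep (l y : List Bool) (c : Bool) (h : y.length ≤ l.length) :
    (l.foldl bleStep (y, c)).2 = true ↔ bval l < bval y ∨ bval l = bval y ∧ c = true := by
  induction l generalizing y c with
  | nil => simp_all
  | cons x l ih =>
    cases y with
    | nil =>
      rw [List.foldl_cons, bleStep, ih _ _ (by simp)]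
      cases x <;> simp
    | cons y z =>
      rw [List.foldl_cons, bleStep, ih _ _ (by simpa using h)]
      cases x <;> cases y <;> simp <;> omega

@[simp] lemma ble_iff (x y : List Bool) : ble x y = true ↔ bval x ≤ bval y := by
  rw [ble, foldl_bleStep _ _ _ (by simp [length_padTo]), bval_padTo]
  simp [le_iff_lt_or_eq]

/-- Conversion of a number from unary to binary. -/
def toBin (n : ℕ) : List Bool := (List.replicate n ()).foldl (fun l _ => badd l [true]) []

@[simp] lemma bval_toBin (n : ℕ) : bval (toBin n) = n := by
  rw [toBin]
  induction n with
  | zero => rfl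
  | succ n ih => rw [List.replicate_succ', List.foldl_append]; simp [ih]

/-- Each `badd` adds one digit, possibly a leading zero. The linear bound suffices because the
argument is given in unary. -/
lemma length_toBin (n : ℕ) : (toBin n).length ≤ n + 1 := by
  rw [toBin]
  induction n with
  | zero => simp
  | succ n ih =>
    rw [List.replicate_succ', List.foldl_append]
    cases n <;> simp_all [length_badd]

lemma sz_bits_le (l : List Bool) : sz l ≤ 4 * l.length + 1 := by
  rw [mul_comm]
  exact sz_list_le fun b _ => sz_bool b

namespace PolyFn

variable {α : Type} [Enc α]

@[fun_prop]
lemma padTo {f g : α → List Bool} (hf : PolyFn f) (hg : PolyFn g) :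
    PolyFn (fun a => padTo (f a) (g a)) :=
  append hf (map (h := fun _ _ => false) (drop (length hf) hg) (by fun_prop))

lemma addStep {f : α → List Bool × Bool × List Bool} {g : α → Bool} (hf : PolyFn f)
    (hg : PolyFn g) : PolyFn (fun a => addStep (f a) (g a)) :=
  list_cases (f := fun a => (f a).1)
    (g := fun a => ([], (f a).2.1 && g a, ((f a).2.1 ^^ g a) :: (f a).2.2))
    (h := fun a y l => (l, (g a && y || (f a).2.1 && (g a || y)),
      ((f a).2.1 ^^ (g a ^^ y)) :: (f a).2.2)) (by fun_prop) (by fun_prop)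
    (by fun_prop) (by simp +contextual [StackProgram.addStep])
    (by simp +contextual [StackProgram.addStep])

lemma bleStep {f : α → List Bool × Bool} {g : α → Bool} (hf : PolyFn f)
    (hg : PolyFn g) : PolyFn (fun a => bleStep (f a) (g a)) :=
  list_cases (f := fun a => (f a).1)
    (g := fun a => ([], (f a).2 && !g a))
    (h := fun a y l => (l, if (g a ^^ y) = true then y else (f a).2))
    (by fun_prop) (by fun_prop) (by fun_prop) (by simp +contextual [StackProgram.bleStep])
    (by simp +contextual [StackProgram.bleStep])

@[fun_prop]
lemma badd {f g : α → List Bool} (hf : PolyFn f) (hg : PolyFn g) :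
    PolyFn (fun a => badd (f a) (g a)) := by
  have h1 (l : List Bool) (s : List Bool × Bool × List Bool) :
      (l.foldl StackProgram.addStep s).1.length ≤ s.1.length ∧
        (l.foldl StackProgram.addStep s).2.2.length = s.2.2.length + l.length := by
    induction l generalizing s with
    | nil => simp
    | cons x l ih =>
      obtain ⟨h1, h2⟩ := ih (StackProgram.addStep s x)
      rw [List.foldl_cons, h2]
      refine ⟨h1.trans ?_, ?_⟩
      · rw [StackProgram.addStep]
        split <;> simp_all
      · rw [StackProgram.addStep]
        split <;> simp <;> omega
  have : PolyFn fun x : List Bool × List Bool => StackProgram.badd x.1 x.2 := by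
    have h := foldl (α := List Bool × List Bool) (L := fun a => StackProgram.padTo a.1 a.2)
      (s := fun a => (a.2, false, [])) (g := fun _ => StackProgram.addStep) (by fun_prop)
      (by fun_prop) (addStep (by fun_prop) (by fun_prop)) (16 * Polynomial.X + 16)
      (fun a l' hl' => by
        obtain ⟨h2, h3⟩ := h1 l' (a.2, false, [])
        have h4 := hl'.length_le
        have h5 := length_padTo a.1 a.2
        have h6 := length_le_sz a.1
        have h7 := length_le_sz a.2
        have h8 := sz_bits_le (l'.foldl StackProgram.addStep (a.2, false, [])).1
        have h9 := sz_bits_le (l'.foldl StackProgram.addStep (a.2, false, [])).2.2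
        have h10 := sz_bool (l'.foldl StackProgram.addStep (a.2, false, [])).2.1
        simp at *
        omega)
    exact ((addStep h (const false)).snd.snd.reverse).of_enc_eq fun a => rfl
  exact this.comp (prodMk hf hg)

@[fun_prop]
lemma binary_ble {f g : α → List Bool} (hf : PolyFn f) (hg : PolyFn g) :
    PolyFn (fun a => StackProgram.ble (f a) (g a)) := by
  have h1 (l : List Bool) (s : List Bool × Bool) :
      (l.foldl StackProgram.bleStep s).1.length ≤ s.1.length := by
    induction l generalizing s with
    | nil => simp
    | cons x l ih =>
      rw [List.foldl_cons]
      refine (ih (StackProgram.bleStep s x)).trans ?_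
      rw [StackProgram.bleStep]
      split <;> simp_all
  have : PolyFn fun x : List Bool × List Bool => StackProgram.ble x.1 x.2 := by
    have h := foldl (α := List Bool × List Bool) (L := fun a => StackProgram.padTo a.1 a.2)
      (s := fun a => (a.2, true)) (g := fun _ => StackProgram.bleStep) (by fun_prop)
      (by fun_prop) (bleStep (by fun_prop) (by fun_prop)) (4 * Polynomial.X + 8)
      (fun a l' hl' => by
        have h2 := h1 l' (a.2, true)
        have h7 := length_le_sz a.2
        have h8 := sz_bits_le (l'.foldl StackProgram.bleStep (a.2, true)).1
        have h10 := sz_bool (l'.foldl StackProgram.bleStep (a.2, true)).2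
        simp at *
        omega)
    exact h.snd
  exact this.comp (prodMk hf hg)

@[fun_prop]
lemma toBin {f : α → ℕ} (hf : PolyFn f) : PolyFn (fun a => toBin (f a)) := by
  have : PolyFn StackProgram.toBin :=
    foldl (α := ℕ) (L := fun a => List.replicate a ()) (s := fun _ => ([] : List Bool))
      (g := fun _ l _ => StackProgram.badd l [true]) (by fun_prop) (by fun_prop) (by fun_prop)
      (4 * Polynomial.X + 5)
      (fun a l' hl' => by
        have h1 := (List.prefix_replicate_iff.1 hl').1
        have h2 := sz_bits_le (StackProgram.toBin l'.length)
        have h3 := length_toBin l'.length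
        rw [(List.prefix_replicate_iff.1 hl').2]
        change sz (StackProgram.toBin l'.length) ≤ _
        simp
        omega)
  fun_prop

end PolyFn

end StackProgram

/-! ### Input and output: from `PolyFn` to a Turing machine. -/

namespace StackProgram

open Enc (enc)
open BinTree

/-- All symbols that are not bits are identified; they serve as separators only. -/
instance : Enc Γ' where
  enc
    | .bit b => .cons .nil (enc b)
    | _ => .nil

lemma sz_symbol (x : Γ') : sz x ≤ 5 := by
  cases x with
  | bit b => cases b <;> simp [sz, enc, size]
  | _ => simp [sz, enc, size]

lemma PolyFn.symbol_cases {α β : Type} [Enc α] [Enc β] {f : α → Γ'} {g : α → Bool → β}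
    {h k : α → β} (hf : PolyFn f) (hg : PolyFn fun x : α × Bool => g x.1 x.2) (hh : PolyFn h)
    (h₁ : ∀ a b, f a = .bit b → k a = g a b) (h₂ : ∀ a, (∀ b, f a ≠ .bit b) → k a = h a) :
    PolyFn k := by
  refine cases_of (fun a => ∃ b, f a = .bit b) hf ?_ ?_ ?_ ?_
  · rintro a ⟨b, hb⟩
    exact ⟨.nil, enc b, by rw [hb]; rfl⟩
  · intro a ha
    cases hfa : f a with
    | bit b => exact absurd ⟨b, hfa⟩ ha
    | _ => rfl
  · have h3 : PolyFn fun a : {a // ∃ b, f a = .bit b} => sectionΓ'Bool (f a.1) :=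
      (hf.restrict _).tail_of fun ⟨a, b, hb⟩ => ⟨.nil, by simp only [hb]; rfl⟩
    refine (hg.comp (prodMk (val id) h3)).of_enc_eq ?_
    rintro ⟨a, b, hb⟩
    simp only [hb, h₁ a b hb]
    rfl
  · exact (hh.restrict _).of_enc_eq fun a => by rw [h₂ _ (not_exists.1 a.2)]

namespace Frag

/-- Move the contents of the input stack to the main stack, as a list in reverse order. -/
def readInput : Frag :=
  (push .main (.bit false)).seq
    (sw .inp (fun x => (pushWord (enc x).code).seq (push .main (.bit true))) (fun _ => true))

lemma readInput_runs (l : List Γ') : readInput.Runs (stk l [] [] [] [])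
    (onMain (enc l.reverse).code) (8 * l.length + 2) := by
  have key (l l' : List Γ') :
      (sw .inp (fun x => (pushWord (enc x).code).seq (push .main (.bit true)))
        (fun _ => true)).Runs (stk l (enc l').code [] [] []) (onMain (enc (l.reverse ++ l')).code)
          (8 * l.length + 1) := by
    induction l generalizing l' with
    | nil => simpa using sw_runs_nil (by simp)
    | cons x l ih =>
      have h1 := pushWord_runs l (enc l').code [] [] (enc x).code
      have h2 := push_runs .main (.bit true) (stk l ((enc x).code ++ (enc l').code) [] [] [])
      have h3 : (enc (x :: l')).code = .bit true :: ((enc x).code ++ (enc l').code) := rfl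
      simp only [stk_main, update_main] at h2
      rw [← h3] at h2
      have h4 := ih (x :: l')
      rw [List.reverse_cons, List.append_assoc, List.singleton_append]
      refine (sw_runs_again (x := x) (r := l) (by simp) rfl (by simp) (h1.seq h2) h4).mono ?_
      have := sz_symbol x
      simp only [length_code, List.length_cons]
      rw [sz] at this
      omega
  have h1 := push_runs .main (.bit false) (stk l [] [] [] [])
  have h2 := key l []
  simp only [stk_main, update_main, List.append_nil] at h1 h2
  exact (h1.seq h2).mono (by omega)

/-- Write the truth value on top of the main stack to the output stack. -/
def writeOutput : Frag :=
  (sw .main (fun x => push .out (sectionΓ'Bool x)) (fun _ => false)).seq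
    (sw .main (fun _ => skip) (fun _ => true))

/-- The first symbol of the code of a truth value is that value itself. The rest is erased, since a
halting configuration requires all other stacks to be empty. -/
lemma writeOutput_runs (b : Bool) : writeOutput.Runs (onMain (enc b).code)
    (update (onMain []) .out [b]) 10 := by
  have key (l : List Γ') : (sw .main (fun _ => skip) (fun _ => true)).Runs
      (update (onMain l) .out [b]) (update (onMain []) .out [b]) (2 * l.length + 1) := by
    induction l with
    | nil => exact sw_runs_nil (by simp)
    | cons x l ih =>
      refine (sw_runs_again (x := x) (r := l) (by simp) rfl (S₁ := update (onMain l) .out [b])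
        ?_ (skip_runs _) ih).mono (by simp; omega)
      rw [update_comm (by decide), update_main]
  have h1 (m : List Γ') : (sw .main (fun x => push .out (sectionΓ'Bool x)) (fun _ => false)).Runs
      (onMain (.bit b :: m)) (update (onMain m) .out [b]) 2 :=
    sw_runs_stop (x := Γ'.bit b) (r := m) (by simp) rfl (by simp) (push_runs .out b _)
  cases b
  · exact ((h1 []).seq (key [])).mono (by simp)
  · exact ((h1 [.bit false, .bit false]).seq (key _)).mono (by simp)

end Frag

/-- A problem is decided in polynomial time if its truth value is a polynomial-time function of the
(reversed) encoding. -/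
theorem decidableInPolyTime_of_polyFn {α : Type} {e : α → List Γ'} {P : α → Prop}
    {f : List Γ' → Bool} (hf : PolyFn f) (h : ∀ a, f (e a).reverse = true ↔ P a) :
    DecidableInPolyTime e P := by
  obtain ⟨F, p, hF⟩ := hf
  refine ⟨fun a => f (e a).reverse, h, ⟨{
    tm := (Frag.readInput.seq (F.seq Frag.writeOutput)).toFinTM2
    inputAlphabet := Equiv.refl _
    outputAlphabet := Equiv.refl _
    time := 8 * Polynomial.X + p.comp (6 * Polynomial.X + 1) + 13
    outputsFun := fun a => Classical.choice ?_ }⟩⟩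
  have h1 := Frag.readInput_runs (e a)
  have h2 := (hF (e a).reverse).2 []
  have h3 := Frag.writeOutput_runs (f (e a).reverse)
  simp only [List.append_nil] at h2
  obtain ⟨t, ht, hr⟩ := h1.seq (h2.seq h3) none
  have h4 := Frag.iterate_step_of_runsFrom hr
  have h5 : sz (e a).reverse ≤ 6 * (e a).length + 1 := by
    rw [sz_reverse, mul_comm]
    exact sz_list_le fun x _ => sz_symbol x
  have h6 := eval_mono p h5
  refine ⟨⟨⟨t + 1, ?_⟩, ?_⟩⟩
  · set M := (Frag.readInput.seq (F.seq Frag.writeOutput)).toFinTM2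
    have h7 : initList M (List.map (Equiv.refl Γ').invFun (e a)) =
        (⟨some (some (Frag.readInput.seq (F.seq Frag.writeOutput)).entry), none,
          stk (e a) [] [] [] []⟩ : TM2.Cfg Alphabet _ _) := by
      refine congrArg (TM2.Cfg.mk _ _) ?_
      funext k
      cases k <;> first | rfl | exact List.map_id _
    have h8 : haltList M (List.map (Equiv.refl Bool).invFun (encodeBool (f (e a).reverse))) =
        (⟨none, none, update (onMain []) .out [f (e a).reverse]⟩ : TM2.Cfg Alphabet _ _) := by
      refine congrArg (TM2.Cfg.mk _ _) ?_
      funext k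
      cases k <;> rfl
    exact (congrArg (fun c => (flip bind M.step)^[t + 1] (some c)) h7).trans
      (h4.trans (congrArg some h8.symm))
  · simp only [Polynomial.eval_add, Polynomial.eval_mul, Polynomial.eval_comp, Polynomial.eval_X,
      Polynomial.eval_ofNat, Polynomial.eval_one]
    omega

end StackProgram

/-! ### The decision procedure: eliminating vertices from a functional graph. -/

namespace StackProgram

open Enc (enc)

/-- Two numbers and a cost in binary. -/
abbrev Entry := ℕ × ℕ × List Bool

/-- A list of entries. -/
abbrev Table := List Entry

/-- A vertex, its successor, and a table: an entry `(a, b, x)` means that an inflow of `a` can be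
turned into an outflow of `b` at cost `x`. -/
abbrev Vertex := ℕ × ℕ × Table

/-- An entry of minimal cost. -/
def best (T : Table) : Table :=
  match T.filter fun e => T.all fun e' => ble e.2.2 e'.2.2 with
  | [] => []
  | e :: _ => [e]

/-- For all `a, b < N`, keep one entry `(a, b, x)` of minimal cost. -/
def prune (N : ℕ) (T : Table) : Table :=
  (List.range N).flatMap fun a => (List.range N).flatMap fun b =>
    best (T.filter fun e => Nat.beq e.1 a && Nat.beq e.2.1 b)

/-- Combine all entries of two tables by adding their costs. -/
def combine (κ : Entry → Entry → List (ℕ × ℕ)) (T T' : Table) : Table :=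
  T.flatMap fun e => T'.flatMap fun e' => (κ e e').map fun k => (k.1, k.2, badd e.2.2 e'.2.2)

/-- The combination of a vertex without inflow with its successor. -/
def leafKey (e e' : Entry) : List (ℕ × ℕ) :=
  if (Nat.beq e.1 0 && Nat.ble e.2.1 e'.1) = true then [(e'.1 - e.2.1, e'.2.1)] else []

/-- The combination of a vertex with its successor, if that has no other inflow. -/
def contractKey (e e' : Entry) : List (ℕ × ℕ) :=
  if Nat.beq e.2.1 e'.1 = true then [(e.1, e'.2.1)] else []

/-- The combination of a vertex whose only inflow is its own outflow with the total cost. -/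
def loopKey (e _e' : Entry) : List (ℕ × ℕ) :=
  if Nat.beq e.1 e.2.1 = true then [(0, 0)] else []

/-- No vertex other than `u` itself has the successor `u`. -/
def isLeaf (L : List Vertex) (u : Vertex) : Bool :=
  L.all fun c => Nat.beq c.1 u.1 || !Nat.beq c.2.1 u.1

/-- The successor of `u` instead of `u`. -/
def redirect (u : Vertex) (k : ℕ) : ℕ := if Nat.beq k u.1 = true then u.2.1 else k

/-- The change of the vertex `c` when `u` is merged into its successor. -/
def mergeInto (N : ℕ) (leaf : Bool) (u c : Vertex) : Vertex :=
  (c.1, redirect u c.2.1,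
    if Nat.beq c.1 u.2.1 = true then
      prune N (if leaf = true then combine leafKey u.2.2 c.2.2 else combine contractKey u.2.2 c.2.2)
    else c.2.2)

/-- Eliminate the vertex `u`. -/
def eliminate (N : ℕ) (st : Table × List Vertex) (u : Vertex) : Table × List Vertex :=
  if Nat.beq u.2.1 u.1 = true then
    (prune N (combine loopKey u.2.2 st.1), st.2.filter fun c => !Nat.beq c.1 u.1)
  else
    (st.1, (st.2.filter fun c => !Nat.beq c.1 u.1).map (mergeInto N (isLeaf st.2 u) u))

/-- Eliminate one vertex, if possible one without inflow from other vertices. -/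
def elimStep (N : ℕ) (st : Table × List Vertex) : Table × List Vertex :=
  match st.2.filter (isLeaf st.2) ++ st.2 with
  | [] => st
  | u :: _ => eliminate N st u

/-- Eliminate all vertices. -/
def elimAll (N : ℕ) (st : Table × List Vertex) : Table × List Vertex :=
  st.2.foldl (fun s _ => elimStep N s) st

/-- The initial table of a vertex: it can cast a ballot at cost `v` if its inflow is less than the
bound, and delegate at cost `d`. -/
def initTable (n : ℕ) (bound v d : List Bool) : Table :=
  (List.range n).flatMap fun a =>
    (a, a + 1, d) :: if ble (toBin (a + 1)) bound = true then [(a, 0, v)] else []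

/-- The position of the first `true`. -/
def firstTrue (l : List Bool) : ℕ :=
  l.reverse.foldl (fun k b => if b = true then 0 else k + 1) 0

/-- The initial vertex `i` with the given row of the adjacency matrix and costs. -/
def initVertex (n : ℕ) (bound : List Bool) (x : (List Bool × List Bool × List Bool) × ℕ) : Vertex :=
  (x.2, if Nat.ble (firstTrue x.1.1 + 1) x.1.1.length = true then firstTrue x.1.1 else x.2,
    initTable n bound x.1.2.1 x.1.2.2)

/-- Whether the total cost of some solution is at most the budget. -/
def solve (budget bound : List Bool) (l : List (List Bool × List Bool × List Bool)) : Bool :=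
  !((elimAll (l.length + 1)
    ([(0, 0, [])], l.zipIdx.map (initVertex l.length bound))).1.all fun e => !ble e.2.2 budget)

/-- One step of the decomposition of the input into numbers, from right to left. -/
def splitStep (s : List (List Bool)) (x : Γ') : List (List Bool) :=
  match x with
  | .bit b => match s with
    | [] => []
    | c :: s => (b :: c) :: s
  | _ => [] :: s

/-- One step of the grouping of the input into voters, from right to left. -/
def groupStep (s : List (List Bool) × List (List Bool × List Bool × List Bool)) (c : List Bool) :
    List (List Bool) × List (List Bool × List Bool × List Bool) :=
  match s.1 with
  | [] => ([c], s.2)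
  | v :: l => match l with
    | [] => ([c, v], s.2)
    | d :: _ => ([], (c, v, d) :: s.2)

/-- The first element of a list of lists, if there is one. -/
def headOrNil (l : List (List Bool)) : List Bool :=
  match l with
  | [] => []
  | c :: _ => c

/-- The decision procedure, on the reversed input. -/
def decideInput (l : List Γ') : Bool :=
  let s := (l.foldl splitStep []).reverse.foldl groupStep ([], [])
  solve (headOrNil s.1) (headOrNil s.1.tail) s.2

/-! ### A single elimination step takes polynomial time. -/

namespace PolyFn

variable {α β : Type} [Enc α] [Enc β]

@[fun_prop]
lemma best {f : α → Table} (hf : PolyFn f) : PolyFn (fun a => best (f a)) := by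
  have h : PolyFn fun a => (f a).filter fun e => (f a).all fun e' => StackProgram.ble e.2.2 e'.2.2 :=
    filter hf (all (L := fun x : α × Entry => f x.1)
      (h := fun x e' => StackProgram.ble x.2.2.2 e'.2.2) (by fun_prop) (by fun_prop))
  exact list_cases (h := fun _ e _ => [e]) h (const []) (by fun_prop)
    (fun a h => by rw [StackProgram.best, h]) (fun a b l h => by rw [StackProgram.best, h])

@[fun_prop]
lemma prune {f : α → ℕ} {g : α → Table} (hf : PolyFn f) (hg : PolyFn g) :
    PolyFn (fun a => prune (f a) (g a)) :=
  flatMap (range hf) (flatMap (L := fun x : α × ℕ => List.range (f x.1))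
    (h := fun x b => StackProgram.best ((g x.1).filter fun e => Nat.beq e.1 x.2 && Nat.beq e.2.1 b))
    (by fun_prop) (best (filter (L := fun x : (α × ℕ) × ℕ => g x.1.1)
      (h := fun x e => Nat.beq e.1 x.1.2 && Nat.beq e.2.1 x.2) (by fun_prop) (by fun_prop))))

lemma combine {κ : Entry → Entry → List (ℕ × ℕ)} (hκ : PolyFn fun x : Entry × Entry => κ x.1 x.2)
    {f g : α → Table} (hf : PolyFn f) (hg : PolyFn g) : PolyFn (fun a => combine κ (f a) (g a)) :=
  flatMap hf (flatMap (L := fun x : α × Entry => g x.1)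
    (h := fun x e' => (κ x.2 e').map fun k => (k.1, k.2, StackProgram.badd x.2.2.2 e'.2.2))
    (by fun_prop) (map (L := fun x : (α × Entry) × Entry => κ x.1.2 x.2)
      (h := fun x k => (k.1, k.2, StackProgram.badd x.1.2.2.2 x.2.2.2))
      (hκ.comp (g := fun x : (α × Entry) × Entry => (x.1.2, x.2)) (by fun_prop)) (by fun_prop)))

@[fun_prop]
lemma combine_leafKey {f g : α → Table} (hf : PolyFn f) (hg : PolyFn g) :
    PolyFn (fun a => StackProgram.combine leafKey (f a) (g a)) :=
  combine (by unfold leafKey; fun_prop) hf hg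

@[fun_prop]
lemma combine_contractKey {f g : α → Table} (hf : PolyFn f) (hg : PolyFn g) :
    PolyFn (fun a => StackProgram.combine contractKey (f a) (g a)) :=
  combine (by unfold contractKey; fun_prop) hf hg

@[fun_prop]
lemma combine_loopKey {f g : α → Table} (hf : PolyFn f) (hg : PolyFn g) :
    PolyFn (fun a => StackProgram.combine loopKey (f a) (g a)) :=
  combine (by unfold loopKey; fun_prop) hf hg

@[fun_prop]
lemma isLeaf {f : α → List Vertex} {g : α → Vertex} (hf : PolyFn f) (hg : PolyFn g) :
    PolyFn (fun a => isLeaf (f a) (g a)) :=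
  all (h := fun a (c : Vertex) => Nat.beq c.1 (g a).1 || !Nat.beq c.2.1 (g a).1) hf (by fun_prop)

@[fun_prop]
lemma mergeInto {f : α → ℕ} {g : α → Bool} {h k : α → Vertex} (hf : PolyFn f) (hg : PolyFn g)
    (hh : PolyFn h) (hk : PolyFn k) : PolyFn (fun a => mergeInto (f a) (g a) (h a) (k a)) := by
  unfold StackProgram.mergeInto redirect
  fun_prop

@[fun_prop]
lemma eliminate {f : α → ℕ} {g : α → Table × List Vertex} {h : α → Vertex} (hf : PolyFn f)
    (hg : PolyFn g) (hh : PolyFn h) : PolyFn (fun a => eliminate (f a) (g a) (h a)) := by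
  have h1 : PolyFn fun a => (g a).2.filter fun c => !Nat.beq c.1 (h a).1 :=
    filter (h := fun a (c : Vertex) => !Nat.beq c.1 (h a).1) (by fun_prop) (by fun_prop)
  have h2 := map (h := fun a c => StackProgram.mergeInto (f a) (StackProgram.isLeaf (g a).2 (h a))
    (h a) c) h1 (by fun_prop)
  unfold StackProgram.eliminate
  fun_prop

@[fun_prop]
lemma elimStep {f : α → ℕ} {g : α → Table × List Vertex} (hf : PolyFn f) (hg : PolyFn g) :
    PolyFn (fun a => elimStep (f a) (g a)) := by
  have h1 : PolyFn fun a => (g a).2.filter (StackProgram.isLeaf (g a).2) :=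
    filter (h := fun a c => StackProgram.isLeaf (g a).2 c) (by fun_prop) (by fun_prop)
  exact list_cases (h := fun a u _ => StackProgram.eliminate (f a) (g a) u)
    (append h1 (snd hg)) hg (by fun_prop) (fun a h => by rw [StackProgram.elimStep, h])
    (fun a b l h => by rw [StackProgram.elimStep, h])

end PolyFn

end StackProgram

/-! ### Size bounds during the elimination, and polynomial time of the whole procedure. -/

namespace StackProgram

open Enc (enc)

lemma best_subset (T : Table) : best T ⊆ T := by
  rw [best]
  split
  · simp
  · rename_i e l h
    intro e' he'
    rw [List.mem_singleton] at he'
    subst he'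
    exact List.mem_of_mem_filter (h ▸ List.mem_cons_self)

lemma length_best (T : Table) : (best T).length ≤ 1 := by
  rw [best]
  split <;> simp

lemma mem_prune {N : ℕ} {T : Table} {e : Entry} (h : e ∈ prune N T) :
    e ∈ T ∧ e.1 < N ∧ e.2.1 < N := by
  simp only [prune, List.mem_flatMap, List.mem_range] at h
  obtain ⟨a, ha, b, hb, h⟩ := h
  have := best_subset _ h
  simp only [List.mem_filter, Bool.and_eq_true, Nat.beq_eq] at this
  obtain ⟨h1, rfl, rfl⟩ := this
  exact ⟨h1, ha, hb⟩

lemma length_flatMap_le {α β : Type} {l : List α} {f : α → List β} {B : ℕ}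
    (h : ∀ a ∈ l, (f a).length ≤ B) : (l.flatMap f).length ≤ l.length * B := by
  induction l with
  | nil => simp
  | cons a l ih =>
    have h1 := h a (by simp)
    have h2 := ih fun b hb => h b (by simp [hb])
    simp only [List.flatMap_cons, List.length_cons, List.length_append]
    linarith

/-- One entry survives for each pair of flows, whatever the costs are; this is what stops `combine`
from blowing up the tables. -/
lemma length_prune (N : ℕ) (T : Table) : (prune N T).length ≤ N * N := by
  refine (length_flatMap_le (B := N) fun a _ => ?_).trans (by simp)
  exact (length_flatMap_le (B := 1) fun b _ => length_best _).trans (by simp)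

/-- All numbers in the table are at most `B`, all costs have at most `k` digits, and there are not
too many entries. -/
structure Table.Bounded (B k : ℕ) (T : Table) : Prop where
  length : T.length ≤ B + B * B
  entry : ∀ e ∈ T, e.1 ≤ B ∧ e.2.1 ≤ B ∧ e.2.2.length ≤ k

/-- All parts of the state are of bounded size. -/
structure StateBounded (B k : ℕ) (st : Table × List Vertex) : Prop where
  total : Table.Bounded B k st.1
  length : st.2.length ≤ B
  vertex : ∀ c ∈ st.2, c.1 ≤ B ∧ c.2.1 ≤ B ∧ Table.Bounded B k c.2.2

lemma Table.Bounded.mono {B k k' : ℕ} {T : Table} (h : T.Bounded B k) (hk : k ≤ k') :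
    T.Bounded B k' :=
  ⟨h.length, fun e he => ⟨(h.entry e he).1, (h.entry e he).2.1, (h.entry e he).2.2.trans hk⟩⟩

/-- Pruning restores the bounds on the number of entries and on the flows, so only the cost digits
grow, by one for the single addition. -/
lemma Table.Bounded.prune_combine {B k N : ℕ} {T T' : Table} (h : T.Bounded B k)
    (h' : T'.Bounded B k) (hN : N ≤ B) (κ : Entry → Entry → List (ℕ × ℕ)) :
    Table.Bounded B (k + 1) (prune N (combine κ T T')) := by
  refine ⟨(length_prune _ _).trans ((Nat.mul_le_mul hN hN).trans (by omega)), fun e he => ?_⟩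
  obtain ⟨h1, h2, h3⟩ := mem_prune he
  refine ⟨by omega, by omega, ?_⟩
  simp only [combine, List.mem_flatMap, List.mem_map] at h1
  obtain ⟨e₁, he₁, e₂, he₂, p, -, rfl⟩ := h1
  have := (h.entry _ he₁).2.2
  have := (h'.entry _ he₂).2.2
  rw [length_badd]
  omega

lemma StateBounded.eliminate {B k N : ℕ} {st : Table × List Vertex} (h : StateBounded B k st)
    (hN : N ≤ B) {u : Vertex} (hu : u ∈ st.2) : StateBounded B (k + 1) (eliminate N st u) := by
  rw [StackProgram.eliminate]
  split
  · refine ⟨(h.vertex u hu).2.2.prune_combine h.total hN _,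
      (List.length_filter_le _ _).trans h.length, fun c hc => ?_⟩
    obtain ⟨h1, h2, h3⟩ := h.vertex c (List.mem_of_mem_filter hc)
    exact ⟨h1, h2, h3.mono (by omega)⟩
  · refine ⟨h.total.mono (by omega), ?_, fun c hc => ?_⟩
    · rw [List.length_map]
      exact (List.length_filter_le _ _).trans h.length
    · rw [List.mem_map] at hc
      obtain ⟨c, hc, rfl⟩ := hc
      obtain ⟨h1, h2, h3⟩ := h.vertex c (List.mem_of_mem_filter hc)
      refine ⟨h1, ?_, ?_⟩
      · simp only [mergeInto, redirect]
        split
        · exact (h.vertex u hu).2.1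
        · exact h2
      · simp only [mergeInto]
        split
        · split <;> exact (h.vertex u hu).2.2.prune_combine h3 hN _
        · exact h3.mono (by omega)

/-- The vertex to be eliminated is among the vertices. -/
lemma elimStep_eq (N : ℕ) (st : Table × List Vertex) :
    (st.2 = [] ∧ elimStep N st = st) ∨ ∃ u ∈ st.2, elimStep N st = eliminate N st u ∧
      (isLeaf st.2 u = true ∨ ∀ c ∈ st.2, isLeaf st.2 c = false) := by
  rw [elimStep]
  split
  · rename_i h
    exact .inl ⟨(List.append_eq_nil_iff.1 h).2, rfl⟩
  · rename_i u l h
    have hu : u ∈ st.2.filter (isLeaf st.2) ++ st.2 := h ▸ List.mem_cons_self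
    refine .inr ⟨u, ?_, rfl, ?_⟩
    · rcases List.mem_append.1 hu with hu | hu
      · exact List.mem_of_mem_filter hu
      · exact hu
    · cases h' : st.2.filter (isLeaf st.2) with
      | nil => exact .inr fun c hc => by simpa using List.filter_eq_nil_iff.1 h' c hc
      | cons v l' =>
        rw [h', List.cons_append, List.cons_eq_cons] at h
        have hv : v ∈ st.2.filter (isLeaf st.2) := h' ▸ List.mem_cons_self
        rw [h.1] at hv
        exact .inl (List.mem_filter.1 hv).2

lemma StateBounded.elimStep {B k N : ℕ} {st : Table × List Vertex} (h : StateBounded B k st)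
    (hN : N ≤ B) : StateBounded B (k + 1) (elimStep N st) := by
  rcases elimStep_eq N st with ⟨-, h'⟩ | ⟨u, hu, h', -⟩
  · rw [h']
    exact ⟨h.total.mono (by omega), h.length, fun c hc => ⟨(h.vertex c hc).1, (h.vertex c hc).2.1,
      (h.vertex c hc).2.2.mono (by omega)⟩⟩
  · rw [h']
    exact h.eliminate hN hu

/-- `PolyFn` speaks about all inputs, also meaningless ones, so the initial bounds come from the
size alone. Unpruned tables are the reason for the summand `B` next to `B * B` in `Table.Bounded`.
-/
lemma Table.bounded_of_sz_le {T : Table} {B : ℕ} (h : sz T ≤ B) : T.Bounded B B := by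
  refine ⟨?_, fun e he => ?_⟩
  · have := length_le_sz T
    omega
  · have h1 := sz_le_of_mem he
    have h2 := length_le_sz e.2.2
    simp at h1
    exact ⟨by omega, by omega, by omega⟩

lemma stateBounded_of_sz_le {st : Table × List Vertex} {B : ℕ} (h : sz st ≤ B) :
    StateBounded B B st := by
  have h1 := length_le_sz st.2
  simp only [sz_prod] at h
  refine ⟨Table.bounded_of_sz_le (by omega), by omega, fun c hc => ?_⟩
  have h2 := sz_le_of_mem hc
  simp only [sz_prod, sz_nat] at h2
  exact ⟨by omega, by omega, Table.bounded_of_sz_le (by omega)⟩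

lemma Table.Bounded.sz_le {B k : ℕ} {T : Table} (h : T.Bounded B k) :
    sz T ≤ (B + B * B) * (4 * B + 4 * k + 6) + 1 := by
  refine (sz_list_le (B := 4 * B + 4 * k + 5) fun e he => ?_).trans
    (Nat.add_le_add_right (Nat.mul_le_mul_right _ h.length) _)
  obtain ⟨h1, h2, h3⟩ := h.entry e he
  have := sz_bits_le e.2.2
  simp
  omega

lemma StateBounded.sz_le {B k : ℕ} {st : Table × List Vertex} (h : StateBounded B k st) :
    sz st ≤ (B + B * B) * (4 * B + 4 * k + 6) + 1 +
      (B * ((B + B * B) * (4 * B + 4 * k + 6) + 1 + 4 * B + 5) + 1) + 1 := by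
  have h1 : sz st.2 ≤ B * ((B + B * B) * (4 * B + 4 * k + 6) + 1 + 4 * B + 5) + 1 := by
    refine (sz_list_le (B := (B + B * B) * (4 * B + 4 * k + 6) + 1 + 4 * B + 4) fun c hc => ?_).trans
      (Nat.add_le_add_right (Nat.mul_le_mul_right _ h.length) _)
    obtain ⟨h1, h2, h3⟩ := h.vertex c hc
    have := h3.sz_le
    simp
    omega
  have := h.total.sz_le
  simp only [sz_prod]
  omega

namespace PolyFn

variable {α : Type} [Enc α]

@[fun_prop]
lemma elimAll {f : α → ℕ} {g : α → Table × List Vertex} (hf : PolyFn f) (hg : PolyFn g) :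
    PolyFn (fun a => elimAll (f a) (g a)) := by
  have : PolyFn fun x : ℕ × Table × List Vertex => StackProgram.elimAll x.1 x.2 := by
    refine foldl (L := fun x : ℕ × Table × List Vertex => x.2.2) (s := fun x => x.2)
      (g := fun x s _ => StackProgram.elimStep x.1 s) (by fun_prop) (by fun_prop) (by fun_prop)
      ((.X + .X * .X) * (4 * .X + 4 * (2 * .X) + 6) + 1 +
      (.X * ((.X + .X * .X) * (4 * .X + 4 * (2 * .X) + 6) + 1 + 4 * .X + 5) + 1) + 1 :
        Polynomial ℕ) fun x l' hl' => ?_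
    have h1 := length_le_sz x.2.2
    have h2 := hl'.length_le
    -- The number of steps is at most `sz x`, so the digit bound grows from `sz x` to at most `2 *
    -- sz x`, the value used in the polynomial above.
    have key (l : List Vertex) (k : ℕ) (st : Table × List Vertex) (h : StateBounded (sz x) k st) :
        StateBounded (sz x) (k + l.length)
          (l.foldl (fun s _ => StackProgram.elimStep x.1 s) st) := by
      induction l generalizing k st with
      | nil => exact h
      | cons c l ih =>
        rw [List.foldl_cons, List.length_cons, ← add_assoc, add_right_comm]
        exact ih _ _ (h.elimStep (by simp; omega))
    have h3 := key l' (sz x) x.2 (stateBounded_of_sz_le (by simp; omega))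
    refine h3.sz_le.trans ?_
    simp only [Polynomial.eval_add, Polynomial.eval_mul, Polynomial.eval_X,
      Polynomial.eval_ofNat, Polynomial.eval_one]
    have : sz x + l'.length ≤ 2 * sz x := by
      simp only [sz_prod] at h1 h2 ⊢
      omega
    gcongr
  exact (this.comp (prodMk hf hg) :)

@[fun_prop]
lemma initTable {f : α → ℕ} {g h k : α → List Bool} (hf : PolyFn f) (hg : PolyFn g) (hh : PolyFn h)
    (hk : PolyFn k) : PolyFn (fun a => initTable (f a) (g a) (h a) (k a)) :=
  flatMap (h := fun x a => (a, a + 1, k x) ::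
    if StackProgram.ble (StackProgram.toBin (a + 1)) (g x) = true then [(a, 0, h x)] else [])
    (by fun_prop) (by fun_prop)

@[fun_prop]
lemma firstTrue {f : α → List Bool} (hf : PolyFn f) : PolyFn (fun a => firstTrue (f a)) := by
  have key (l : List Bool) : l.foldl (fun k b => if b = true then 0 else k + 1) 0 ≤ l.length := by
    induction l using List.reverseRecOn with
    | nil => simp
    | append_singleton l b ih => cases b <;> simp [ih]
  have : PolyFn StackProgram.firstTrue :=
    foldl (α := List Bool) (L := fun l => l.reverse) (s := fun _ => 0)
      (g := fun _ k b => if b = true then 0 else k + 1) (by fun_prop) (by fun_prop) (by fun_prop)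
      (2 * Polynomial.X + 1) fun l l' hl' => by
        have h1 := key l'
        have h2 := hl'.length_le
        have h3 := length_le_sz l
        simp at *
        omega
  fun_prop

@[fun_prop]
lemma initVertex {f : α → ℕ} {g : α → List Bool} {h : α → (List Bool × List Bool × List Bool) × ℕ}
    (hf : PolyFn f) (hg : PolyFn g) (hh : PolyFn h) :
    PolyFn (fun a => initVertex (f a) (g a) (h a)) := by
  unfold StackProgram.initVertex
  fun_prop

@[fun_prop]
lemma zipIdx {β : Type} [Enc β] {f : α → List β} (hf : PolyFn f) :
    PolyFn (fun a => (f a).zipIdx) := by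
  have key (l : List β) : l.foldl (fun s b => s ++ [(b, s.length)]) [] = l.zipIdx := by
    induction l using List.reverseRecOn with
    | nil => rfl
    | append_singleton l b ih => simp [ih, List.zipIdx_append]
  have : PolyFn (fun l : List β => l.zipIdx) := by
    have := foldl (α := List β) (L := fun l => l) (s := fun _ => ([] : List (β × ℕ)))
      (g := fun _ s b => s ++ [(b, s.length)]) (by fun_prop) (by fun_prop) (by fun_prop)
      (.X * (3 * .X + 3) + 1) fun l l' hl' => by
        rw [key]
        have h1 := hl'.length_le
        have h2 := length_le_sz l
        refine (sz_list_le (B := 3 * sz l + 2) fun x hx => ?_).trans ?_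
        · have h3 := sz_le_of_mem (hl'.subset (List.fst_mem_of_mem_zipIdx hx))
          have h4 := List.snd_lt_of_mem_zipIdx hx
          simp
          omega
        · simp only [Polynomial.eval_add, Polynomial.eval_mul, Polynomial.eval_X,
            Polynomial.eval_ofNat, Polynomial.eval_one, List.length_zipIdx]
          exact Nat.add_le_add_right (Nat.mul_le_mul (by omega) (by omega)) 1
    exact this.of_enc_eq fun l => by rw [key]
  fun_prop

@[fun_prop]
lemma solve {f g : α → List Bool} {h : α → List (List Bool × List Bool × List Bool)}
    (hf : PolyFn f) (hg : PolyFn g) (hh : PolyFn h) :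
    PolyFn (fun a => solve (f a) (g a) (h a)) := by
  have h1 := map (h := fun a x => StackProgram.initVertex (h a).length (g a) x) (zipIdx hh)
    (by fun_prop)
  have h2 : PolyFn fun a => (StackProgram.elimAll ((h a).length + 1)
    ([(0, 0, [])], (h a).zipIdx.map (StackProgram.initVertex (h a).length (g a)))).1 := by
    fun_prop
  exact not (all (h := fun a e => !StackProgram.ble e.2.2 (f a)) h2 (by fun_prop))

lemma splitStep {f : α → List (List Bool)} {g : α → Γ'} (hf : PolyFn f) (hg : PolyFn g) :
    PolyFn (fun a => splitStep (f a) (g a)) := by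
  have h1 : PolyFn fun x : α × Bool => match f x.1 with
      | [] => []
      | c :: s => (x.2 :: c) :: s :=
    list_cases (f := fun x : α × Bool => f x.1) (h := fun x c s => (x.2 :: c) :: s) (by fun_prop)
      (const []) (by fun_prop) (fun a h => by rw [h]) (fun a b l h => by rw [h])
  refine symbol_cases (h := fun a => [] :: f a) (g := fun a b => match f a with
    | [] => []
    | c :: s => (b :: c) :: s) hg h1 (by fun_prop) (fun a b h => ?_) (fun a h => ?_)
  · rw [h]
    rfl
  · cases ha : g a with
    | bit b => exact absurd ha (h b)
    | _ => rfl

lemma groupStep {f : α → List (List Bool) × List (List Bool × List Bool × List Bool)}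
    {g : α → List Bool} (hf : PolyFn f) (hg : PolyFn g) :
    PolyFn (fun a => groupStep (f a) (g a)) := by
  have h1 : PolyFn fun x : α × List Bool × List (List Bool) => match x.2.2 with
      | [] => ([g x.1, x.2.1], (f x.1).2)
      | d :: _ => ([], (g x.1, x.2.1, d) :: (f x.1).2) :=
    list_cases (f := fun x : α × List Bool × List (List Bool) => x.2.2)
      (g := fun x => ([g x.1, x.2.1], (f x.1).2))
      (h := fun x d _ => ([], (g x.1, x.2.1, d) :: (f x.1).2)) (by fun_prop) (by fun_prop)
      (by fun_prop) (fun a h => by rw [h]) (fun a b l h => by rw [h])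
  exact list_cases (f := fun a => (f a).1) (g := fun a => ([g a], (f a).2))
    (h := fun a v l => match l with
      | [] => ([g a, v], (f a).2)
      | d :: _ => ([], (g a, v, d) :: (f a).2)) (by fun_prop) (by fun_prop) h1
      (fun a h => by rw [StackProgram.groupStep, h])
      (fun a b l h => by rw [StackProgram.groupStep, h])

@[fun_prop]
lemma headOrNil {f : α → List (List Bool)} (hf : PolyFn f) : PolyFn (fun a => headOrNil (f a)) :=
  list_cases (g := fun _ => []) (h := fun _ c _ => c) hf (by fun_prop) (by fun_prop)
    (fun a h => by rw [h]; rfl) (fun a b l h => by rw [h]; rfl)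

lemma decideInput : PolyFn decideInput := by
  have h1 : PolyFn fun l : List Γ' => l.foldl StackProgram.splitStep [] :=
    foldl (L := fun l : List Γ' => l) (s := fun _ => []) (g := fun _ => StackProgram.splitStep)
      (by fun_prop) (by fun_prop) (splitStep (by fun_prop) (by fun_prop)) (4 * .X + 1)
      fun l l' hl' => by
        have key (l : List Γ') : sz (l.foldl StackProgram.splitStep []) ≤ 4 * l.length + 1 := by
          induction l using List.reverseRecOn with
          | nil => simp
          | append_singleton l x ih =>
            rw [List.foldl_append, List.foldl_cons, List.foldl_nil]
            cases x with
            | bit b =>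
              cases h : l.foldl StackProgram.splitStep [] with
              | nil => simp [StackProgram.splitStep]
              | cons c s =>
                have := sz_bool b
                rw [h] at ih
                simp [StackProgram.splitStep] at *
                omega
            | _ =>
              simp [StackProgram.splitStep]
              omega
        have h1 := key l'
        have h2 := hl'.length_le
        have h3 := length_le_sz l
        simp at *
        omega
  have h2 : PolyFn fun l : List (List Bool) => l.foldl StackProgram.groupStep ([], []) :=
    foldl (L := fun l : List (List Bool) => l) (s := fun _ => ([], []))
      (g := fun _ => StackProgram.groupStep)
      (by fun_prop) (by fun_prop) (groupStep (by fun_prop) (by fun_prop)) (4 * .X + 3)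
      fun l l' hl' => by
        have key (l : List (List Bool)) :
            sz (l.foldl StackProgram.groupStep ([], [])) ≤ 4 * sz l + 3 := by
          induction l using List.reverseRecOn with
          | nil => simp
          | append_singleton l x ih =>
            rw [List.foldl_append, List.foldl_cons, List.foldl_nil, StackProgram.groupStep]
            have h4 := sz_append l [x]
            split
            · simp at *
              omega
            · rename_i v l₁ h
              split
              · rw [sz_prod, h] at ih
                simp at *
                omega
              · rw [sz_prod, h] at ih
                simp at *
                omega
        have h1 := key l'
        have h3 := sz_le_of_sublist hl'.sublist
        simp at *
        omega
  have h3 : PolyFn fun l : List Γ' => (l.foldl StackProgram.splitStep []).reverse.foldl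
    StackProgram.groupStep ([], []) := comp h2 (reverse h1)
  unfold StackProgram.decideInput
  fun_prop

end PolyFn

end StackProgram

/-! ### Correctness of the elimination. -/

namespace StackProgram

lemma exists_mem_best {T : Table} {e : Entry} (h : e ∈ T) :
    ∃ e' ∈ best T, bval e'.2.2 ≤ bval e.2.2 := by
  obtain ⟨m, hm, hmin⟩ := T.toFinset.exists_min_image (fun e => bval e.2.2) ⟨e, by simpa⟩
  rw [best]
  split
  · rename_i h'
    have := List.filter_eq_nil_iff.1 h' m (by simpa using hm)
    simp at this
    obtain ⟨a, b, x, hx, hlt⟩ := this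
    have := hmin (a, b, x) (by simpa)
    simp at this
    omega
  · rename_i e' l h'
    have : e' ∈ T.filter fun e => T.all fun e' => ble e.2.2 e'.2.2 := h' ▸ List.mem_cons_self
    rw [List.mem_filter, List.all_eq_true] at this
    exact ⟨e', List.mem_cons_self, by simpa using this.2 e h⟩

/-- The table has an entry `(a, b, y)` for some cost `y ≤ x`. -/
def Allows (T : Table) (a b x : ℕ) : Prop := ∃ e ∈ T, e.1 = a ∧ e.2.1 = b ∧ bval e.2.2 ≤ x

/-- `Allows` is monotone in the cost, so for each pair of flows a cheapest entry carries all the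
information. -/
lemma allows_prune {N : ℕ} {T : Table} {a b x : ℕ} :
    Allows (prune N T) a b x ↔ a < N ∧ b < N ∧ Allows T a b x := by
  constructor
  · rintro ⟨e, he, rfl, rfl, hx⟩
    obtain ⟨h1, h2, h3⟩ := mem_prune he
    exact ⟨h2, h3, e, h1, rfl, rfl, hx⟩
  · rintro ⟨ha, hb, e, he, rfl, rfl, hx⟩
    obtain ⟨e', he', hle⟩ :=
      exists_mem_best (T := T.filter fun e' => Nat.beq e'.1 e.1 && Nat.beq e'.2.1 e.2.1) (e := e)
        (by simpa using he)
    have := best_subset _ he'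
    simp only [List.mem_filter, Bool.and_eq_true, Nat.beq_eq] at this
    refine ⟨e', ?_, this.2.1, this.2.2, hle.trans hx⟩
    simp only [prune, List.mem_flatMap, List.mem_range]
    exact ⟨e.1, ha, e.2.1, hb, he'⟩

lemma beq_eq_false_iff {a b : ℕ} : Nat.beq a b = false ↔ a ≠ b := by
  rw [← Bool.not_eq_true, Nat.beq_eq]

/-- A vertex without inflow sends `j` to its successor, which therefore receives `a + j` when the
remaining predecessors send `a`. -/
lemma allows_leaf {T T' : Table} {a b x : ℕ} : Allows (combine leafKey T T') a b x ↔
    ∃ j x₁ x₂, Allows T 0 j x₁ ∧ Allows T' (a + j) b x₂ ∧ x₁ + x₂ ≤ x := by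
  constructor
  · rintro ⟨e, he, rfl, rfl, hx⟩
    simp only [combine, List.mem_flatMap, List.mem_map, leafKey] at he
    obtain ⟨e₁, h₁, e₂, h₂, p, hp, rfl⟩ := he
    split at hp
    · rename_i h
      simp only [Bool.and_eq_true, Nat.beq_eq, Nat.ble_eq] at h
      rw [List.mem_singleton] at hp
      subst hp
      simp only [bval_badd] at hx
      exact ⟨e₁.2.1, _, _, ⟨e₁, h₁, h.1, rfl, le_rfl⟩, ⟨e₂, h₂, by simp; omega, rfl, le_rfl⟩, hx⟩
    · simp at hp
  · rintro ⟨j, x₁, x₂, ⟨e₁, h₁, h₁a, h₁b, h₁x⟩, ⟨e₂, h₂, h₂a, h₂b, h₂x⟩, hx⟩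
    refine ⟨(a, b, badd e₁.2.2 e₂.2.2), ?_, rfl, rfl, by simp; omega⟩
    simp only [combine, List.mem_flatMap, List.mem_map]
    exact ⟨e₁, h₁, e₂, h₂, (a, b), by simp [leafKey, *], rfl⟩

/-- The min-plus product of the two tables: the outflow `j` of the first vertex is the whole inflow
of the second. -/
lemma allows_contract {T T' : Table} {a b x : ℕ} : Allows (combine contractKey T T') a b x ↔
    ∃ j x₁ x₂, Allows T a j x₁ ∧ Allows T' j b x₂ ∧ x₁ + x₂ ≤ x := by
  constructor
  · rintro ⟨e, he, rfl, rfl, hx⟩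
    simp only [combine, List.mem_flatMap, List.mem_map, contractKey] at he
    obtain ⟨e₁, h₁, e₂, h₂, p, hp, rfl⟩ := he
    split at hp
    · rename_i h
      simp only [Nat.beq_eq] at h
      rw [List.mem_singleton] at hp
      subst hp
      simp only [bval_badd] at hx
      exact ⟨e₁.2.1, _, _, ⟨e₁, h₁, rfl, rfl, le_rfl⟩, ⟨e₂, h₂, h.symm, rfl, le_rfl⟩, hx⟩
    · simp at hp
  · rintro ⟨j, x₁, x₂, ⟨e₁, h₁, h₁a, h₁b, h₁x⟩, ⟨e₂, h₂, h₂a, h₂b, h₂x⟩, hx⟩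
    refine ⟨(a, b, badd e₁.2.2 e₂.2.2), ?_, rfl, rfl, by simp; omega⟩
    simp only [combine, List.mem_flatMap, List.mem_map]
    exact ⟨e₁, h₁, e₂, h₂, (a, b), by simp [contractKey, *], rfl⟩

/-- Only diagonal entries of `T` are consistent on a loop. The flows stored in the total table have
no meaning and are set to 0. -/
lemma allows_loop {T T' : Table} {a b x : ℕ} : Allows (combine loopKey T T') a b x ↔
    a = 0 ∧ b = 0 ∧ ∃ j x₁ a' b' x₂, Allows T j j x₁ ∧ Allows T' a' b' x₂ ∧ x₁ + x₂ ≤ x := by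
  constructor
  · rintro ⟨e, he, rfl, rfl, hx⟩
    simp only [combine, List.mem_flatMap, List.mem_map, loopKey] at he
    obtain ⟨e₁, h₁, e₂, h₂, p, hp, rfl⟩ := he
    split at hp
    · rename_i h
      simp only [Nat.beq_eq] at h
      rw [List.mem_singleton] at hp
      subst hp
      simp only [bval_badd] at hx
      exact ⟨rfl, rfl, e₁.2.1, _, _, _, _, ⟨e₁, h₁, h, rfl, le_rfl⟩, ⟨e₂, h₂, rfl, rfl, le_rfl⟩, hx⟩
    · simp at hp
  · rintro ⟨rfl, rfl, j, x₁, a', b', x₂, ⟨e₁, h₁, h₁a, h₁b, h₁x⟩, ⟨e₂, h₂, h₂a, h₂b, h₂x⟩, hx⟩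
    refine ⟨(0, 0, badd e₁.2.2 e₂.2.2), ?_, rfl, rfl, by simp; omega⟩
    simp only [combine, List.mem_flatMap, List.mem_map]
    exact ⟨e₁, h₁, e₂, h₂, (0, 0), by simp [loopKey, *], rfl⟩

/-- The sum of the outflows of the vertices with successor `k`. -/
def inflow (L : List Vertex) (f : ℕ → ℕ) (k : ℕ) : ℕ :=
  (L.map fun c => if c.2.1 = k then f c.1 else 0).sum

/-- There are outflows of the vertices that are allowed by the tables at a total cost of at
most `y`. -/
def Solvable (st : Table × List Vertex) (y : ℕ) : Prop :=
  ∃ (f x : ℕ → ℕ) (a b z : ℕ), Allows st.1 a b z ∧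
    (∀ c ∈ st.2, Allows c.2.2 (inflow st.2 f c.1) (f c.1) (x c.1)) ∧
    z + (st.2.map fun c => x c.1).sum ≤ y

@[simp] lemma inflow_cons (u : Vertex) (L : List Vertex) (f : ℕ → ℕ) (k : ℕ) :
    inflow (u :: L) f k = (if u.2.1 = k then f u.1 else 0) + inflow L f k := by
  simp [inflow]

lemma inflow_perm {L L' : List Vertex} (h : L.Perm L') (f : ℕ → ℕ) (k : ℕ) :
    inflow L f k = inflow L' f k := (h.map _).sum_eq

lemma inflow_congr {L : List Vertex} {f f' : ℕ → ℕ} (h : ∀ c ∈ L, f c.1 = f' c.1) (k : ℕ) :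
    inflow L f k = inflow L f' k := by
  rw [inflow, inflow]
  exact congrArg _ (List.map_congr_left fun c hc => by rw [h c hc])

lemma inflow_eq_zero {L : List Vertex} {k : ℕ} (h : ∀ c ∈ L, c.2.1 ≠ k) (f : ℕ → ℕ) :
    inflow L f k = 0 :=
  List.sum_eq_zero fun x hx => by
    obtain ⟨c, hc, rfl⟩ := List.mem_map.1 hx
    rw [if_neg (h c hc)]

lemma solvable_perm {T : Table} {L L' : List Vertex} (h : L.Perm L') {y : ℕ} :
    Solvable (T, L) y ↔ Solvable (T, L') y := by
  simp only [Solvable, inflow_perm h, h.mem_iff, (h.map _).sum_eq]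

lemma sum_update {R : List Vertex} (h : (R.map Prod.fst).Nodup) {c : Vertex} (hc : c ∈ R)
    (x : ℕ → ℕ) (v : ℕ) : (R.map fun c' => update x c.1 v c'.1).sum + x c.1 =
      (R.map fun c' => x c'.1).sum + v := by
  induction R with
  | nil => simp at hc
  | cons d R ih =>
    simp only [List.map_cons, List.nodup_cons, List.mem_map, not_exists, not_and] at h
    rcases List.mem_cons.1 hc with rfl | hc
    · have : (R.map fun c' => update x c.1 v c'.1) = R.map fun c' => x c'.1 :=
        List.map_congr_left fun c' hc' => update_of_ne (h.1 c' hc') _ _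
      simp [this]
      omega
    · have := ih h.2 hc
      have h1 : d.1 ≠ c.1 := fun h' => h.1 c hc h'.symm
      simp [update_of_ne h1] at this ⊢
      omega

lemma allows_congr {T : Table} {a a' b b' x x' : ℕ} (h : Allows T a b x) (ha : a = a')
    (hb : b = b') (hx : x = x') : Allows T a' b' x' := by
  subst ha hb hx
  exact h

variable {N : ℕ} {T : Table} {u : Vertex} {R : List Vertex} {y : ℕ}

/-- The vertex `u` exchanges flow with no other vertex, so its outflow and cost can be chosen
independently of the rest. -/
lemma solvable_loop (hu : ∀ c ∈ R, c.1 ≠ u.1) (hs : u.2.1 = u.1) (hl : ∀ c ∈ R, c.2.1 ≠ u.1)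
    (hN : 0 < N) : Solvable (prune N (combine loopKey u.2.2 T), R) y ↔ Solvable (T, u :: R) y := by
  constructor
  · rintro ⟨f, x, a, b, z, hT, hR, hy⟩
    obtain ⟨-, -, hT⟩ := allows_prune.1 hT
    obtain ⟨-, -, j, x₁, a', b', x₂, h₁, h₂, hx⟩ := allows_loop.1 hT
    have hf : ∀ c ∈ R, update f u.1 j c.1 = f c.1 := fun c hc => update_of_ne (hu c hc) _ _
    have hx' : ∀ c ∈ R, update x u.1 x₁ c.1 = x c.1 := fun c hc => update_of_ne (hu c hc) _ _
    refine ⟨update f u.1 j, update x u.1 x₁, a', b', x₂, h₂, fun c hc => ?_, ?_⟩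
    · rw [inflow_cons]
      rcases List.mem_cons.1 hc with rfl | hc
      · exact allows_congr h₁ (by simp [hs, inflow_eq_zero hl]) (by simp) (by simp)
      · exact allows_congr (hR c hc)
          (by simp [hs, (hu c hc).symm, inflow_congr hf]) (hf c hc).symm (hx' c hc).symm
    · have : (R.map fun c => update x u.1 x₁ c.1) = R.map fun c => x c.1 := List.map_congr_left hx'
      simp only [List.map_cons, update_self, List.sum_cons, this] at hy ⊢
      omega
  · rintro ⟨f, x, a, b, z, hT, hR, hy⟩
    have h₁ := hR u List.mem_cons_self
    simp only [inflow_cons, hs, if_true, inflow_eq_zero hl, add_zero] at h₁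
    refine ⟨f, x, 0, 0, x u.1 + z, allows_prune.2 ⟨hN, hN, allows_loop.2 ⟨rfl, rfl, _, _, _, _, _,
      h₁, hT, le_rfl⟩⟩, fun c hc => ?_, ?_⟩
    · have := hR c (List.mem_cons_of_mem _ hc)
      simpa [hs, (hu c hc).symm] using this
    · simp only [List.map_cons, List.sum_cons] at hy ⊢
      omega

/-- The common core of both ways to merge `u` into its successor `p`. If the merged vertex has
inflow `a` and `u` has outflow `j`, then `u` had inflow `α a` and `p` had inflow `β a j`. For a leaf
these are `0` and `a + j`, for a contraction `a` and `j`. The hypothesis `hαβ` ensures that pruning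
loses no flow that is needed. -/
lemma solvable_merge {α : ℕ → ℕ} {β : ℕ → ℕ → ℕ} {leaf : Bool} (hu : ∀ c ∈ R, c.1 ≠ u.1)
    (hR : (R.map Prod.fst).Nodup) {p : Vertex} (hp : p ∈ R) (hs : u.2.1 = p.1)
    (hM : ∀ a b x, Allows (mergeInto N leaf u p).2.2 a b x ↔ a < N ∧ b < N ∧
      ∃ j x₁ x₂, Allows u.2.2 (α a) j x₁ ∧ Allows p.2.2 (β a j) b x₂ ∧ x₁ + x₂ ≤ x)
    (hN : ∀ a b x, Allows u.2.2 a b x → a < N)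
    (hN' : ∀ a b x, Allows p.2.2 a b x → a < N ∧ b < N)
    (hαβ : ∀ a j, α a < N → β a j < N → a < N)
    (hα : ∀ f, inflow (u :: R) f u.1 = α (inflow (R.map (mergeInto N leaf u)) f p.1))
    (hβ : ∀ f, inflow (u :: R) f p.1 = β (inflow (R.map (mergeInto N leaf u)) f p.1) (f u.1))
    (hk : ∀ f, ∀ c ∈ R, c.1 ≠ p.1 →
      inflow (u :: R) f c.1 = inflow (R.map (mergeInto N leaf u)) f c.1) :
    Solvable (T, R.map (mergeInto N leaf u)) y ↔ Solvable (T, u :: R) y := by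
  have hinj : ∀ c ∈ R, c.1 = p.1 → c = p := fun c hc h => List.inj_on_of_nodup_map hR hc hp h
  have hne : ∀ c ∈ R, c.1 ≠ p.1 → (mergeInto N leaf u c).2.2 = c.2.2 := fun c hc h => by
    simp [mergeInto, hs, h]
  constructor
  · rintro ⟨f, x, a, b, z, hT, hA, hy⟩
    have hA' : ∀ c ∈ R, Allows (mergeInto N leaf u c).2.2
        (inflow (R.map (mergeInto N leaf u)) f c.1) (f c.1) (x c.1) := fun c hc =>
      hA _ (List.mem_map_of_mem hc)
    obtain ⟨-, -, j, x₁, x₂, h₁, h₂, hx⟩ := (hM _ _ _).1 (hA' p hp)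
    have hf : ∀ c ∈ R, f c.1 = update f u.1 j c.1 := fun c hc => (update_of_ne (hu c hc) _ _).symm
    have hi : ∀ k, inflow (R.map (mergeInto N leaf u)) f k =
        inflow (R.map (mergeInto N leaf u)) (update f u.1 j) k :=
      inflow_congr fun c hc => by
        obtain ⟨d, hd, rfl⟩ := List.mem_map.1 hc
        exact hf d hd
    -- The cost of the merged vertex is split into the parts `x₁` of `u` and `x₂` of `p`, and the
    -- hidden flow `j` becomes the outflow of `u`.
    refine ⟨update f u.1 j, update (update x p.1 x₂) u.1 x₁, a, b, z, hT, fun c hc => ?_, ?_⟩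
    · rcases List.mem_cons.1 hc with rfl | hc
      · exact allows_congr h₁ (by rw [hα, hi]) (by simp) (by simp)
      · by_cases hcp : c.1 = p.1
        · obtain rfl := hinj c hc hcp
          exact allows_congr h₂ (by simp only [hβ, hi, update_self]) (hf _ hc)
            (by rw [update_of_ne (hu _ hc), update_self])
        · have := hA' c hc
          rw [hne c hc hcp] at this
          exact allows_congr this (by simp only [hk _ c hc hcp, hi]) (hf _ hc)
            (by rw [update_of_ne (hu _ hc), update_of_ne hcp])
    · have h3 : (R.map fun c => update (update x p.1 x₂) u.1 x₁ c.1) =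
          R.map fun c => update x p.1 x₂ c.1 :=
        List.map_congr_left fun c hc => update_of_ne (hu c hc) _ _
      have h4 := sum_update hR hp x x₂
      simp only [List.map_map, comp_def, mergeInto] at hy
      simp only [List.map_cons, update_self, List.sum_cons, h3]
      omega
  · rintro ⟨f, x, a, b, z, hT, hA, hy⟩
    have h₁ := hA u List.mem_cons_self
    have h₂ := hA p (List.mem_cons_of_mem _ hp)
    rw [hα] at h₁
    simp only [hβ] at h₂
    refine ⟨f, update x p.1 (x u.1 + x p.1), a, b, z, hT, fun c hc => ?_, ?_⟩
    · obtain ⟨d, hd, rfl⟩ := List.mem_map.1 hc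
      by_cases hcp : d.1 = p.1
      · obtain rfl := hinj d hd hcp
        refine allows_congr ((hM _ _ (x u.1 + x d.1)).2 ⟨?_, (hN' _ _ _ h₂).2, _, _, _, h₁, h₂,
          le_rfl⟩) rfl rfl ?_
        · exact hαβ _ _ (hN _ _ _ h₁) (hN' _ _ _ h₂).1
        · exact (update_self (mergeInto N leaf u d).1 (x u.1 + x d.1) x).symm
      · have h3 := hA d (List.mem_cons_of_mem _ hd)
        simp only [hk f d hd hcp] at h3
        rw [hne d hd hcp]
        exact allows_congr h3 rfl rfl (update_of_ne hcp ..).symm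
    · have h4 := sum_update hR hp x (x u.1 + x p.1)
      simp only [List.map_map, comp_def, mergeInto]
      simp only [List.map_cons, List.sum_cons] at hy
      omega

/-- The vertices have distinct numbers, their successors are among them, and all flows in the
tables are less than `N`. -/
structure WellFormed (N : ℕ) (L : List Vertex) : Prop where
  nodup : (L.map Prod.fst).Nodup
  succ : ∀ c ∈ L, ∃ c' ∈ L, c'.1 = c.2.1
  lt : ∀ c ∈ L, ∀ e ∈ c.2.2, e.1 < N ∧ e.2.1 < N

lemma WellFormed.perm {L : List Vertex} (h : WellFormed N L) (hu : u ∈ L) :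
    L.Perm (u :: L.filter fun c => !Nat.beq c.1 u.1) := by
  have hL : L.Nodup := h.nodup.of_map
  refine (List.perm_ext_iff_of_nodup hL ?_).2 fun c => ?_
  · simp [hL.filter]
  · simp only [List.mem_cons, List.mem_filter, Bool.not_eq_true', beq_eq_false_iff]
    constructor
    · intro hc
      by_cases hcu : c.1 = u.1
      · exact .inl (List.inj_on_of_nodup_map h.nodup hc hu hcu)
      · exact .inr ⟨hc, hcu⟩
    · rintro (rfl | h)
      exacts [hu, h.1]

lemma isLeaf_iff {L : List Vertex} : isLeaf L u = true ↔ ∀ c ∈ L, c.1 ≠ u.1 → c.2.1 ≠ u.1 := by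
  simp only [isLeaf, List.all_eq_true, Bool.or_eq_true, Nat.beq_eq, Bool.not_eq_true',
    beq_eq_false_iff, or_iff_not_imp_left, ne_eq]

/-- Without leaves every vertex is a successor. The list of successors then contains all the
distinct vertex numbers and has the same length, so it is a permutation of them. -/
lemma WellFormed.succ_injOn {L : List Vertex} (h : WellFormed N L)
    (hL : ∀ c ∈ L, isLeaf L c = false) : ∀ c ∈ L, ∀ c' ∈ L, c.2.1 = c'.2.1 → c = c' := by
  have h1 : L.map Prod.fst ⊆ L.map fun c => c.2.1 := by
    intro k hk
    obtain ⟨u, hu, rfl⟩ := List.mem_map.1 hk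
    have := hL u hu
    rw [← Bool.not_eq_true, isLeaf_iff] at this
    push Not at this
    obtain ⟨c, hc, -, hcu⟩ := this
    exact List.mem_map.2 ⟨c, hc, hcu⟩
  have h2 := (List.subperm_of_subset h.nodup h1).perm_of_length_le (by simp)
  exact fun c hc c' hc' => List.inj_on_of_nodup_map (h2.nodup_iff.1 h.nodup) hc hc'

lemma solvable_elimStep {st : Table × List Vertex} (h : WellFormed N st.2) (hN : 0 < N) :
    WellFormed N (elimStep N st).2 ∧ (elimStep N st).2.length = st.2.length - 1 ∧
      ∀ y, Solvable (elimStep N st) y ↔ Solvable st y := by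
  rcases elimStep_eq N st with ⟨h1, h2⟩ | ⟨u, hu, h1, h2⟩
  · rw [h2]
    exact ⟨h, by simp [h1], fun y => Iff.rfl⟩
  rw [h1]
  obtain ⟨T, L⟩ := st
  simp only at h h2 hu
  have hL := h.perm hu
  set R := L.filter fun c => !Nat.beq c.1 u.1 with hRdef
  have hlen : R.length = L.length - 1 := by simp [hL.length_eq]
  have hnd := (hL.map Prod.fst).nodup_iff.1 h.nodup
  simp only [List.map_cons, List.nodup_cons, List.mem_map, not_exists, not_and] at hnd
  obtain ⟨hu', hR⟩ := hnd
  have hRL : ∀ c ∈ R, c ∈ L := fun c hc => List.mem_of_mem_filter hc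
  have hmem : ∀ c ∈ L, c.1 ≠ u.1 → c ∈ R := fun c hc hcu => by
    rcases List.mem_cons.1 (hL.mem_iff.1 hc) with rfl | hc
    exacts [absurd rfl hcu, hc]
  have hlt : ∀ c ∈ L, ∀ a b x, Allows c.2.2 a b x → a < N ∧ b < N := by
    rintro c hc a b x ⟨e, he, rfl, rfl, -⟩
    exact h.lt c hc e he
  have hE : eliminate N (T, L) u = if Nat.beq u.2.1 u.1 = true then
    (prune N (combine loopKey u.2.2 T), R) else (T, R.map (mergeInto N (isLeaf L u) u)) := rfl
  clear_value R
  rw [hE]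
  split
  · rename_i hs
    rw [Nat.beq_eq] at hs
    -- No other vertex flows into the loop: either `u` is a leaf, or the successor map is injective
    -- and `u` already is a predecessor of itself.
    have hl : ∀ c ∈ R, c.2.1 ≠ u.1 := fun c hc => by
      rcases h2 with h2 | h2
      · exact isLeaf_iff.1 h2 c (hRL c hc) (hu' c hc)
      · intro hcu
        have := h.succ_injOn h2 c (hRL c hc) u hu (hcu.trans hs.symm)
        exact hu' c hc (congrArg _ this)
    refine ⟨⟨hR, fun c hc => ?_, fun c hc => h.lt c (hRL c hc)⟩, hlen, fun y => ?_⟩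
    · obtain ⟨c', hc', hcc'⟩ := h.succ c (hRL c hc)
      exact ⟨c', hmem c' hc' (hcc' ▸ hl c hc), hcc'⟩
    · rw [solvable_perm hL]
      exact solvable_loop hu' hs hl hN
  · rename_i hs
    rw [Nat.beq_eq] at hs
    obtain ⟨p, hpL, hpu⟩ := h.succ u hu
    have hp := hmem p hpL (hpu ▸ hs)
    have hcomb : (mergeInto N (isLeaf L u) u p).2.2 = prune N (if isLeaf L u = true then
        combine leafKey u.2.2 p.2.2 else combine contractKey u.2.2 p.2.2) := by
      simp [mergeInto, hpu]
    refine ⟨⟨?_, fun c hc => ?_, fun c hc => ?_⟩, by simpa using hlen, fun y => ?_⟩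
    · simpa [List.map_map, comp_def, mergeInto] using hR
    · obtain ⟨d, hd, rfl⟩ := List.mem_map.1 hc
      suffices ∃ c' ∈ R, c'.1 = redirect u d.2.1 by
        obtain ⟨c', hc', hcc'⟩ := this
        exact ⟨_, List.mem_map_of_mem hc', hcc'⟩
      rw [redirect]
      split
      · exact ⟨p, hp, hpu⟩
      · rename_i hcu
        obtain ⟨c', hc', hcc'⟩ := h.succ d (hRL d hd)
        exact ⟨c', hmem c' hc' (by rw [Nat.beq_eq] at hcu; rwa [hcc']), hcc'⟩
    · obtain ⟨d, hd, rfl⟩ := List.mem_map.1 hc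
      intro e he
      simp only [mergeInto] at he
      split at he
      · exact (mem_prune he).2
      · exact h.lt d (hRL d hd) e he
    rw [solvable_perm hL]
    have hin (f : ℕ → ℕ) (k : ℕ) : inflow (R.map (mergeInto N (isLeaf L u) u)) f k =
        (R.map fun c => if redirect u c.2.1 = k then f c.1 else 0).sum := by
      simp [inflow, List.map_map, comp_def, mergeInto]
    rcases Bool.eq_false_or_eq_true (isLeaf L u) with hleaf | hleaf
    · have hl : ∀ c ∈ R, c.2.1 ≠ u.1 := fun c hc =>
        isLeaf_iff.1 hleaf c (hRL c hc) (hu' c hc)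
      have hin' (f : ℕ → ℕ) (k : ℕ) : inflow (R.map (mergeInto N (isLeaf L u) u)) f k =
          inflow R f k := by
        rw [hin, inflow]
        exact congrArg _ (List.map_congr_left fun c hc => by simp [redirect, hl c hc])
      refine solvable_merge (α := fun _ => 0) (β := fun a j => a + j) hu' hR hp hpu.symm ?_
        (fun a b x h => (hlt u hu a b x h).1) (hlt p hpL) (fun a j _ h => by omega)
        (fun f => ?_) (fun f => ?_) (fun f c hc hcp => ?_)
      · intro a b x
        rw [hcomb, if_pos hleaf, allows_prune, allows_leaf]
      · simp [hs, inflow_eq_zero hl]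
      · simp [hin', hpu, add_comm]
      · simp [hin', ← hpu, Ne.symm hcp]
    · have hinj := h.succ_injOn (h2.resolve_left (by simp [hleaf]))
      -- By injectivity `u` is the only predecessor of `p`, so the outflow of `u` is the entire
      -- inflow of `p`.
      have hl : ∀ c ∈ R, c.2.1 ≠ u.2.1 := fun c hc hcu =>
        hu' c hc (congrArg _ (hinj c (hRL c hc) u hu hcu))
      refine solvable_merge (α := fun a => a) (β := fun _ j => j) hu' hR hp hpu.symm ?_
        (fun a b x h => (hlt u hu a b x h).1) (hlt p hpL) (fun a j h _ => h)
        (fun f => ?_) (fun f => ?_) (fun f c hc hcp => ?_)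
      · intro a b x
        rw [hcomb, if_neg (by simp [hleaf]), allows_prune, allows_contract]
      · rw [hin, inflow_cons, if_neg hs, zero_add, inflow]
        refine congrArg _ (List.map_congr_left fun c hc => ?_)
        by_cases hcu : c.2.1 = u.1
        · simp [redirect, hcu, hpu]
        · simp [redirect, hcu, hpu, hl c hc]
      · rw [inflow_cons, if_pos hpu.symm, hpu, inflow_eq_zero hl, add_zero]
      · rw [hin, inflow_cons, if_neg (by rw [← hpu]; exact Ne.symm hcp), zero_add, inflow]
        refine congrArg _ (List.map_congr_left fun d hd => ?_)
        by_cases hdu : d.2.1 = u.1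
        · simp [redirect, hdu, Ne.symm (hu' c hc), ← hpu, Ne.symm hcp]
        · simp [redirect, hdu]

/-- The fold uses the vertex list only as a counter: each step removes a vertex, and when none is
left solvability is a condition on the total table alone. -/
lemma solvable_elimAll {st : Table × List Vertex} (h : WellFormed N st.2) (hN : 0 < N) (y : ℕ) :
    Solvable st y ↔ ∃ e ∈ (elimAll N st).1, bval e.2.2 ≤ y := by
  have key (l : List Vertex) (st : Table × List Vertex) (h : WellFormed N st.2)
      (hl : st.2.length ≤ l.length) :
      (l.foldl (fun s _ => elimStep N s) st).2 = [] ∧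
        (Solvable (l.foldl (fun s _ => elimStep N s) st) y ↔ Solvable st y) := by
    induction l generalizing st with
    | nil => exact ⟨by simpa using hl, Iff.rfl⟩
    | cons c l ih =>
      obtain ⟨h1, h2, h3⟩ := solvable_elimStep h hN
      rw [List.length_cons] at hl
      rw [List.foldl_cons, ← h3 y]
      exact ih _ h1 (by omega)
  obtain ⟨h1, h2⟩ := key st.2 st h le_rfl
  change (elimAll N st).2 = [] at h1
  change Solvable (elimAll N st) y ↔ _ at h2
  rw [← h2, Solvable, h1]
  constructor
  · rintro ⟨_, _, a, b, z, ⟨e, he, -, -, hez⟩, -, hy⟩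
    exact ⟨e, he, hez.trans (by simpa using hy)⟩
  · rintro ⟨e, he, hey⟩
    exact ⟨id, id, e.1, e.2.1, bval e.2.2, ⟨e, he, rfl, rfl, le_rfl⟩, by simp, by simpa using hey⟩

end StackProgram

/-! ### Decoding the input, and the flow formulation. -/

namespace StackProgram

open BoundedPowerInstance (encodeNumber)

lemma foldr_splitStep_encodeNumber (w : List Bool) (l : List Γ') :
    (w.map Γ'.bit ++ [Γ'.comma] ++ l).foldr (fun x s => splitStep s x) [] =
      w :: l.foldr (fun x s => splitStep s x) [] := by
  induction w with
  | nil => simp [splitStep]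
  | cons b w ih =>
    simp only [List.append_assoc, List.map_cons, List.cons_append, List.foldr_cons] at ih ⊢
    rw [ih, splitStep]

open Classical in
/-- The adjacencies and the costs of the voter `i`. -/
noncomputable def voterData (I : BoundedPowerInstance) (i : Fin I.n) :
    List Bool × List Bool × List Bool :=
  ((List.finRange I.n).map fun j => decide (I.election.graph.Adj i j),
    encodeNat (I.election.votingCost i), encodeNat (I.election.delegationCost i))

lemma foldr_splitStep_encode (I : BoundedPowerInstance) :
    I.encode.foldr (fun x s => splitStep s x) [] = encodeNat I.budget :: encodeNat I.bound ::
      (List.finRange I.n).flatMap fun i =>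
        [(voterData I i).1, (voterData I i).2.1, (voterData I i).2.2] := by
  rw [BoundedPowerInstance.encode, encodeNumber, encodeNumber, List.append_assoc,
    foldr_splitStep_encodeNumber, foldr_splitStep_encodeNumber]
  congr 2
  induction List.finRange I.n with
  | nil => rfl
  | cons i l ih =>
    rw [List.flatMap_cons, List.flatMap_cons, ← ih]
    simp only [BoundedPowerInstance.encodeRow, encodeNumber]
    have : (fun j => Γ'.bit (@decide (I.election.graph.Adj i j) (Classical.propDecidable _))) =
        Γ'.bit ∘ fun j => @decide (I.election.graph.Adj i j) (Classical.propDecidable _) := rfl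
    rw [this, ← List.map_map, List.append_assoc, List.append_assoc, foldr_splitStep_encodeNumber,
      foldr_splitStep_encodeNumber, foldr_splitStep_encodeNumber]
    rfl

/-- Rows and numbers are all words ended by a comma. Grouping them in threes from the right leaves
budget and bound at the front. -/
lemma decideInput_encode (I : BoundedPowerInstance) : decideInput I.encode.reverse =
    solve (encodeNat I.budget) (encodeNat I.bound) ((List.finRange I.n).map (voterData I)) := by
  have key : ∀ l : List (Fin I.n), (l.flatMap fun i =>
      [(voterData I i).1, (voterData I i).2.1, (voterData I i).2.2]).foldr
        (fun x s => groupStep s x) ([], []) = ([], l.map (voterData I)) := fun l => by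
    induction l with
    | nil => rfl
    | cons i l ih =>
      rw [List.flatMap_cons, List.foldr_append, ih]
      rfl
  rw [decideInput, List.foldl_reverse, List.foldl_reverse, foldr_splitStep_encode, List.foldr_cons,
    List.foldr_cons, key]
  rfl

lemma firstTrue_eq_findIdx (l : List Bool) : firstTrue l = l.findIdx id := by
  rw [firstTrue, List.foldl_reverse]
  induction l with
  | nil => rfl
  | cons b l ih => rw [List.foldr_cons, ih, List.findIdx_cons]; cases b <;> rfl

/-- Here Δ ≤ 1 enters: the first approved voter in a row is the only one. Voters who approve nobody
get themselves as successor, which is also how a self-loop is treated; both kinds must cast. -/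
lemma exists_successor (I : BoundedPowerInstance) (hI : I.election.maxOutDegree ≤ 1) :
    ∃ s : Fin I.n → Fin I.n, (∀ i j, I.election.graph.Adj i j → s i = j) ∧
      (∀ i, s i ≠ i → I.election.graph.Adj i (s i)) ∧
      ∀ i, initVertex I.n (encodeNat I.bound) (voterData I i, i) =
        (i.1, (s i).1, initTable I.n (encodeNat I.bound) (encodeNat (I.election.votingCost i))
          (encodeNat (I.election.delegationCost i))) := by
  have key : ∀ i : Fin I.n, ∃ k : Fin I.n, (∀ j, I.election.graph.Adj i j → k = j) ∧
      (k ≠ i → I.election.graph.Adj i k) ∧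
      (if Nat.ble (firstTrue (voterData I i).1 + 1) (voterData I i).1.length = true then
        firstTrue (voterData I i).1 else i.1) = k.1 := fun i => by
    have hlen : (voterData I i).1.length = I.n := by simp [voterData]
    rw [firstTrue_eq_findIdx]
    by_cases h : (voterData I i).1.findIdx id < (voterData I i).1.length
    · have h1 := List.findIdx_getElem (p := id) (w := h)
      simp only [voterData, List.getElem_map, id, decide_eq_true_eq, List.getElem_finRange] at h1
      refine ⟨_, fun j hj => ?_, fun _ => h1, if_pos (Nat.ble_eq ▸ h)⟩
      have h2 : I.election.outDegree i ≤ 1 :=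
        (Finset.le_sup (f := I.election.outDegree) (Finset.mem_univ i)).trans hI
      exact (Set.ncard_le_one (Set.toFinite _)).1 h2 _ h1 _ hj
    · refine ⟨i, fun j hj => absurd ?_ h, fun h => absurd rfl h, if_neg (by simpa using h)⟩
      exact List.findIdx_lt_length_of_exists ⟨true, by simpa [voterData] using ⟨j, hj⟩, rfl⟩
  choose s h1 h2 h3 using key
  exact ⟨s, h1, h2, fun i => by rw [initVertex, h3]; rfl⟩

lemma allows_initTable {n : ℕ} {bound v d : List Bool} {a b x : ℕ} :
    Allows (initTable n bound v d) a b x ↔ a < n ∧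
      (b = 0 ∧ a < bval bound ∧ bval v ≤ x ∨ b = a + 1 ∧ bval d ≤ x) := by
  constructor
  · rintro ⟨e, he, rfl, rfl, hx⟩
    simp only [initTable, List.mem_flatMap, List.mem_range, List.mem_cons] at he
    obtain ⟨k, hk, rfl | he⟩ := he
    · exact ⟨hk, .inr ⟨rfl, hx⟩⟩
    · split at he
      · rename_i h
        rw [List.mem_singleton] at he
        subst he
        simp only [ble_iff, bval_toBin] at h
        exact ⟨hk, .inl ⟨rfl, h, hx⟩⟩
      · simp at he
  · rintro ⟨ha, ⟨rfl, hb, hx⟩ | ⟨rfl, hx⟩⟩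
    · refine ⟨(a, 0, v), ?_, rfl, rfl, hx⟩
      simp only [initTable, List.mem_flatMap, List.mem_range, List.mem_cons]
      exact ⟨a, ha, .inr (by rw [if_pos (by simpa using hb)]; simp)⟩
    · refine ⟨(a, a + 1, d), ?_, rfl, rfl, hx⟩
      simp only [initTable, List.mem_flatMap, List.mem_range, List.mem_cons]
      exact ⟨a, ha, .inl rfl⟩

/-- `f i` is the power that the voter `i` passes on to its successor `s i`, which is zero if `i`
casts a ballot. -/
def IsFlow {N : Type} [Fintype N] [DecidableEq N] (s : N → N) (bound : ℕ) (f : N → ℕ) : Prop :=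
  ∀ i, ∑ c with s c = i, f c < Fintype.card N ∧
    (f i = 0 ∧ ∑ c with s c = i, f c < bound ∨ f i = ∑ c with s c = i, f c + 1)

lemma solve_eq_true_iff (I : BoundedPowerInstance) {s : Fin I.n → Fin I.n}
    (hs : ∀ i, initVertex I.n (encodeNat I.bound) (voterData I i, i) =
        (i.1, (s i).1, initTable I.n (encodeNat I.bound) (encodeNat (I.election.votingCost i))
          (encodeNat (I.election.delegationCost i)))) :
    solve (encodeNat I.budget) (encodeNat I.bound) ((List.finRange I.n).map (voterData I)) = true ↔
      ∃ f, IsFlow s I.bound f ∧ ∑ i, (if f i = 0 then I.election.votingCost i else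
        I.election.delegationCost i) ≤ I.budget := by
  set g : Fin I.n → Vertex := fun i => (i.1, (s i).1, initTable I.n (encodeNat I.bound)
    (encodeNat (I.election.votingCost i)) (encodeNat (I.election.delegationCost i))) with hg
  have h1 : ((List.finRange I.n).map (voterData I)).zipIdx.map
      (initVertex ((List.finRange I.n).map (voterData I)).length (encodeNat I.bound)) =
      (List.finRange I.n).map g := by
    refine List.ext_getElem (by simp) fun k h _ => ?_
    simpa using hs ⟨k, by simpa using h⟩
  -- Initial inflows are less than `n`, but outflows can reach `n`, hence the bound `n + 1`.
  have hwf : WellFormed (I.n + 1) ((List.finRange I.n).map g) := by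
    refine ⟨?_, ?_, ?_⟩
    · rw [List.map_map]
      exact (List.nodup_finRange _).map Fin.val_injective
    · intro c hc
      obtain ⟨i, -, rfl⟩ := List.mem_map.1 hc
      exact ⟨g (s i), List.mem_map_of_mem (List.mem_finRange _), rfl⟩
    · intro c hc e he
      obtain ⟨i, -, rfl⟩ := List.mem_map.1 hc
      have := allows_initTable.1 (⟨e, he, rfl, rfl, le_rfl⟩ : Allows (g i).2.2 e.1 e.2.1 _)
      omega
  have hin : ∀ (f : ℕ → ℕ) (i : Fin I.n),
      inflow ((List.finRange I.n).map g) f i = ∑ c with s c = i, f c := fun f i => by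
    rw [inflow, List.map_map, ← Fin.sum_univ_def, Finset.sum_filter]
    simp [hg, Fin.ext_iff]
  have hallow : ∀ (i : Fin I.n) (a b x : ℕ), Allows (g i).2.2 a b x ↔ a < I.n ∧
      (b = 0 ∧ a < I.bound ∧ I.election.votingCost i ≤ x ∨
        b = a + 1 ∧ I.election.delegationCost i ≤ x) := fun i a b x => by
    simpa using allows_initTable (bound := encodeNat I.bound)
      (v := encodeNat (I.election.votingCost i)) (d := encodeNat (I.election.delegationCost i))
  have hsum : ∀ x : ℕ → ℕ, (((List.finRange I.n).map g).map fun c => x c.1).sum =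
      ∑ i : Fin I.n, x i := fun x => by
    rw [List.map_map, ← Fin.sum_univ_def]
    rfl
  have h2 : solve (encodeNat I.budget) (encodeNat I.bound) ((List.finRange I.n).map (voterData I)) =
      true ↔ Solvable ([(0, 0, [])], (List.finRange I.n).map g) I.budget := by
    rw [solvable_elimAll hwf (Nat.succ_pos _), solve, h1]
    simp
  rw [h2]
  constructor
  · rintro ⟨f, x, a, b, z, -, h, hy⟩
    have h3 := fun i : Fin I.n => (hallow i _ _ _).1
      (hin f i ▸ h (g i) (List.mem_map_of_mem (List.mem_finRange i)))
    refine ⟨fun i => f i, fun i => ⟨by simpa using (h3 i).1, (h3 i).2.imp (fun h => ⟨h.1, h.2.1⟩)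
      fun h => h.1⟩, le_trans (Finset.sum_le_sum fun i _ => ?_)
      (((hsum x).symm.le.trans (Nat.le_add_left _ z)).trans hy)⟩
    dsimp only
    rcases (h3 i).2 with h | h
    · rw [if_pos h.1]
      exact h.2.2
    · rw [if_neg (h.1.trans_ne (Nat.succ_ne_zero _))]
      exact h.2
  · rintro ⟨f, hf, hy⟩
    let x : Fin I.n → ℕ := fun i => if f i = 0 then I.election.votingCost i else
      I.election.delegationCost i
    -- `Solvable` wants functions on all natural numbers; the values outside the voters are never
    -- read.
    let ext : (Fin I.n → ℕ) → ℕ → ℕ := fun f k => if h : k < I.n then f ⟨k, h⟩ else 0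
    have hext : ∀ f (i : Fin I.n), ext f i = f i := fun f i => dif_pos i.2
    refine ⟨ext f, ext x, 0, 0, 0, ⟨_, List.mem_singleton_self _, rfl, rfl, le_rfl⟩,
      fun c hc => ?_, ?_⟩
    · obtain ⟨i, -, rfl⟩ := List.mem_map.1 hc
      refine (hallow _ _ _ _).2 ?_
      simp only [show (g i).1 = i from rfl, hin, hext]
      refine ⟨by simpa using (hf i).1, (hf i).2.imp (fun h => ⟨h.1, h.2, ?_⟩) fun h => ⟨h, ?_⟩⟩
      · simp [x, h.1]
      · simp only [x]
        rw [if_neg (by omega)]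
    · simp only [hsum, hext, zero_add]
      exact hy

end StackProgram

/-! ### Flows correspond to solutions. -/

namespace CLDElection

variable {N : Type}

lemma IsSolution.mem_iff {e : CLDElection N} {C : Finset N} {D : Set (N × N)}
    (h : e.IsSolution C D) {s : N → N} (hs : ∀ i j, e.graph.Adj i j → s i = j) {i j : N} :
    (i, j) ∈ D ↔ i ∉ C ∧ s i = j := by
  refine ⟨fun hD => ⟨h.casting _ _ hD, hs _ _ (h.edge _ _ hD)⟩, ?_⟩
  rintro ⟨hi, rfl⟩
  obtain ⟨k, hk, -⟩ := h.delegating i hi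
  rwa [hs _ _ (h.edge _ _ hk)]

/-- Paths are deterministic, so from a cycle only the cycle can be reached, and everything there has
an outgoing edge. A reachable casting voter has none. -/
lemma not_hasPath_of_mem {C : Finset N} {D : Set (N × N)} {s : N → N}
    (hD : ∀ i j, (i, j) ∈ D ↔ i ∉ C ∧ s i = j) (hr : Reachability C D) {i j : N}
    (h : (i, j) ∈ D) : ¬ HasPath D j i := by
  intro hp
  obtain ⟨k, hk, hik⟩ := hr i ((hD _ _).1 h).1
  have key : ∀ y, HasPath D i y → HasPath D y i := fun y hy => by
    induction hy with
    | refl => exact .refl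
    | tail _ hyz ih =>
      rcases ih.cases_head with rfl | ⟨z', hz', hp'⟩
      · rwa [← ((hD _ _).1 hyz).2, ((hD _ _).1 h).2]
      · rwa [← ((hD _ _).1 hyz).2, ((hD _ _).1 hz').2]
  rcases (key k hik).cases_head with rfl | ⟨z, hz, -⟩
  · exact ((hD _ _).1 h).1 hk
  · exact ((hD _ _).1 hz).1 hk

variable [Fintype N]

open Classical in
/-- The number of voters with a path to `i`. -/
noncomputable def weight (D : Set (N × N)) (i : N) : ℕ := {x | HasPath D x i}.toFinset.card

/-- The empty path from `j` to itself accounts for the summand 1 in the voting power. -/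
lemma votingPower_eq_weight {C : Finset N} {D : Set (N × N)} (hD : ∀ i j, (i, j) ∈ D → i ∉ C)
    {j : N} (hj : j ∈ C) : votingPower C D j = weight D j := by
  classical
  have h : {x | HasPath D x j} = insert j (represented C D j) := by
    ext x
    simp only [Set.mem_ofPred_eq, Set.mem_insert_iff, represented]
    constructor
    · intro hp
      rcases hp.cases_head with h | ⟨z, hz, -⟩
      · exact .inl h
      · exact .inr ⟨hD _ _ hz, hp⟩
    · rintro (rfl | h)
      · exact .refl
      · exact h.2
  rw [weight, ← Set.ncard_eq_toFinset_card', h, Set.ncard_insert_of_notMem, votingPower]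
  exact fun h => h.1 hj

variable [DecidableEq N]

/-- The voters that reach `i` are `i` itself and those that reach a delegating predecessor. These
sets are disjoint: two predecessors reached from one voter would be joined by a path, as paths are
deterministic, and that path would close a cycle through `i`. -/
lemma weight_eq {C : Finset N} {D : Set (N × N)} {s : N → N}
    (hD : ∀ i j, (i, j) ∈ D ↔ i ∉ C ∧ s i = j) (hr : Reachability C D) (i : N) :
    weight D i = ∑ c with s c = i, (if c ∈ C then 0 else weight D c) + 1 := by
  classical
  have h1 : {x | HasPath D x i}.toFinset =
      insert i ((({c | s c = i} : Finset N).filter (· ∉ C)).biUnion fun c =>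
        {x | HasPath D x c}.toFinset) := by
    ext x
    simp only [Set.mem_toFinset, Set.mem_ofPred_eq, Finset.mem_insert, Finset.mem_biUnion,
      Finset.mem_filter, Finset.mem_univ, true_and]
    rw [HasPath, Relation.ReflTransGen.cases_tail_iff]
    refine or_congr eq_comm (exists_congr fun c => ?_)
    rw [hD, and_comm, and_comm (a := c ∉ C)]
    rfl
  rw [weight, Set.toFinset_congr rfl, h1, Finset.card_insert_of_notMem, Finset.card_biUnion, Finset.sum_filter]
  · simp only [weight, ite_not]
  · intro c hc c' hc' hne
    simp only [Finset.coe_filter, Finset.mem_filter, Finset.mem_univ, true_and,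
      Set.mem_ofPred_eq] at hc hc'
    have h2 : ∀ c c', s c = i → s c' = i → c' ∉ C → c ≠ c' → ¬ HasPath D c c' := by
      intro c c' hc hc' hC hne hp
      rcases hp.cases_head with h | ⟨z, hz, hp⟩
      · exact hne h
      · rw [hD, hc] at hz
        rw [← hz.2] at hp
        exact not_hasPath_of_mem hD hr ((hD _ _).2 ⟨hC, hc'⟩) hp
    rw [Function.onFun, Finset.disjoint_left]
    intro x hx hx'
    simp only [Set.mem_toFinset, Set.mem_ofPred_eq] at hx hx'
    rcases Relation.ReflTransGen.total_of_right_unique (fun a b b' h h' => by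
      rw [← ((hD _ _).1 h).2, ← ((hD _ _).1 h').2]) hx hx' with h | h
    · exact h2 c c' hc.1 hc'.1 hc'.2 hne h
    · exact h2 c' c hc'.1 hc.1 hc.2 hne.symm h
  · simp only [Finset.mem_biUnion, Finset.mem_filter, Finset.mem_univ, true_and,
      Set.mem_toFinset, Set.mem_ofPred_eq, not_exists, not_and]
    exact fun c hc => not_hasPath_of_mem hD hr ((hD _ _).2 hc.symm)

open StackProgram (IsFlow)

lemma exists_isFlow_iff {e : CLDElection N} {s : N → N} (hs : ∀ i j, e.graph.Adj i j → s i = j)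
    (hs' : ∀ i, s i ≠ i → e.graph.Adj i (s i)) {β l : ℕ} :
    (∃ f, IsFlow s l f ∧ ∑ i, (if f i = 0 then e.votingCost i else e.delegationCost i) ≤ β) ↔
    ∃ (C : Finset N) (D : Set (N × N)), e.IsSolution C D ∧ e.cost C ≤ β ∧ Reachability C D ∧
      ∀ j ∈ C, votingPower C D j ≤ l := by
  classical
  have hcost : ∀ (f : N → ℕ) (C : Finset N), (∀ i, f i = 0 ↔ i ∈ C) →
      ∑ i, (if f i = 0 then e.votingCost i else e.delegationCost i) = e.cost C := by
    intro f C h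
    simp only [h]
    rw [cost, Finset.sum_ite, Finset.filter_mem_eq_inter, Finset.univ_inter]
    congr 2
    ext i
    simp
  constructor
  · rintro ⟨f, hf, hy⟩
    -- Inflow strictly increases along delegations. This replaces acyclicity in all that follows and
    -- excludes delegation to oneself.
    have hlt : ∀ i, f i ≠ 0 → ∑ c with s c = i, f c < ∑ c with s c = s i, f c := fun i hi => by
      have h1 : f i ≤ ∑ c with s c = s i, f c :=
        Finset.single_le_sum (f := f) (fun _ _ => Nat.zero_le _) (by simp)
      have := (hf i).2
      omega
    let C : Finset N := {i | f i = 0}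
    let D : Set (N × N) := {p | f p.1 ≠ 0 ∧ s p.1 = p.2}
    have hC : ∀ i, i ∈ C ↔ f i = 0 := fun i => by simp [C]
    have hD : ∀ i j, (i, j) ∈ D ↔ f i ≠ 0 ∧ s i = j := fun i j => Iff.rfl
    -- Only an upper bound on the power is needed, so a union bound suffices and disjointness need
    -- not be shown. The induction is on the inflow.
    have hw : ∀ m i, ∑ c with s c = i, f c ≤ m → weight D i ≤ ∑ c with s c = i, f c + 1 := by
      intro m
      induction m using Nat.strong_induction_on with
      | _ m ih =>
      intro i him
      have h1 : {x | HasPath D x i}.toFinset ⊆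
          insert i ((({c | s c = i} : Finset N).filter (f · ≠ 0)).biUnion fun c =>
            {x | HasPath D x c}.toFinset) := by
        intro x
        simp only [Set.mem_toFinset, Set.mem_ofPred_eq, Finset.mem_insert, Finset.mem_biUnion,
          Finset.mem_filter, Finset.mem_univ, true_and]
        intro hp
        rcases hp.cases_tail with h | ⟨c, hp, hc⟩
        · exact .inl h.symm
        · exact .inr ⟨c, ((hD _ _).1 hc).symm, hp⟩
      refine (Finset.card_le_card h1).trans ((Finset.card_insert_le _ _).trans
        (Nat.add_le_add_right (Finset.card_biUnion_le.trans ?_) 1))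
      refine (Finset.sum_le_sum (g := f) fun c hc => ?_).trans
        (Finset.sum_le_sum_of_subset (Finset.filter_subset _ _))
      simp only [Finset.mem_filter, Finset.mem_univ, true_and] at hc
      have h2 := hlt c hc.2
      rw [hc.1] at h2
      have h3 := ih _ (h2.trans_le him) c le_rfl
      have h4 := (hf c).2
      rw [weight] at h3
      omega
    refine ⟨C, D, ⟨?_, ?_, ?_⟩, ?_, ?_, ?_⟩
    · intro i j h
      obtain ⟨hi, rfl⟩ := (hD i j).1 h
      refine hs' i fun h => ?_
      have := hlt i hi
      rw [h] at this
      exact lt_irrefl _ this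
    · intro i j h
      rw [hC]
      exact h.1
    · intro i hi
      rw [hC] at hi
      exact ⟨s i, ⟨hi, rfl⟩, fun j hj => hj.2.symm⟩
    · rw [← hcost f C fun i => (hC i).symm]
      exact hy
    -- Inflows stay below the number of voters, so their distance to it decreases along delegations
    -- and a casting voter is reached.
    · have key : ∀ m i, Fintype.card N - ∑ c with s c = i, f c ≤ m → ∃ j ∈ C, HasPath D i j := by
        intro m
        induction m with
        | zero =>
          intro i hi
          have := (hf i).1
          omega
        | succ m ih =>
          intro i hi
          by_cases h : f i = 0
          · exact ⟨i, (hC i).2 h, .refl⟩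
          · have := hlt i h
            have := (hf i).1
            obtain ⟨j, hj, hp⟩ := ih (s i) (by omega)
            exact ⟨j, hj, .head (⟨h, rfl⟩ : (i, s i) ∈ D) hp⟩
      exact fun i _ => key _ i le_rfl
    · intro j hj
      rw [votingPower_eq_weight (fun i j h => (hC i).not.2 h.1) hj]
      rw [hC] at hj
      have := hw _ j le_rfl
      have := (hf j).2
      omega
  · rintro ⟨C, D, hsol, hy, hr, hl⟩
    have hD : ∀ i j, (i, j) ∈ D ↔ i ∉ C ∧ s i = j := fun i j => hsol.mem_iff hs
    have hw := weight_eq hD hr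
    -- A delegating voter passes on everyone who reaches it, itself included; its weight is
    -- positive, so the zeros of this flow are exactly the voters in `C`.
    refine ⟨fun i => if i ∈ C then 0 else weight D i, fun i => ⟨?_, ?_⟩, ?_⟩
    · rw [Nat.lt_iff_add_one_le, ← hw i]
      exact Finset.card_le_univ _
    · by_cases hi : i ∈ C
      · refine .inl ⟨if_pos hi, ?_⟩
        rw [Nat.lt_iff_add_one_le, ← hw i, ← votingPower_eq_weight hsol.casting hi]
        exact hl i hi
      · exact .inr ((if_neg hi).trans (hw i))
    · rw [hcost _ C fun i => ?_]
      · exact hy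
      · have := hw i
        simp only [ite_eq_left_iff]
        exact ⟨fun h => by_contra fun hi => by have := h hi; omega, fun h hi => absurd h hi⟩

end CLDElection

theorem mainTheorem5 :
    DecidableInPolyTime
      (fun I : {I : BoundedPowerInstance // I.election.maxOutDegree ≤ 1} => I.1.encode)
      (fun I => I.1.IsYes) := by
  refine StackProgram.decidableInPolyTime_of_polyFn StackProgram.PolyFn.decideInput ?_
  rintro ⟨I, hI⟩
  obtain ⟨s, h1, h2, h3⟩ := StackProgram.exists_successor I hI
  rw [StackProgram.decideInput_encode, StackProgram.solve_eq_true_iff I h3,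
    CLDElection.exists_isFlow_iff h1 h2]
  rfl
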